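/- Fix $L$ targets with pairwise distinct delays $\tau_1,\dots,\tau_L\in\mathbb{R}$ and non-zero complex amplitudes $\beta_1,\dots,\beta_L$, a noise variance $\sigma^2>0$ and a constant $\rho\in(0,1)$, all independent of $N$. Let $\mathcal S\subset\mathbb{C}$ be a finite constellation with a symbol distribution on $\mathcal S$ of zero mean and unit power, $\mathbb{E}(s)=0$, $\mathbb{E}(|s|^2)=1$. For every $N$ let $\mathbf U_N\in\mathbb{C}^{N\times N}$ be an arbitrary unitary matrix and $\mathbf s_N$ a random vector of $N$ independent symbols with this distribution; all $\mathbf s_N$ are defined on one probability space, with arbitrary dependence between different $N$. Let $\mathbf F_N$ be the normalized $N$-point DFT matrix, $\mathbf P_\tau=\mathbf F_N^H\operatorname{Diag}\{e^{-j2\pi n\tau/N}\}_{n=0}^{N-1}\mathbf F_N$, and let $\boldsymbol\mu_{\boldsymbol\theta}=\sum_{\ell=1}^L\beta_\ell\mathbf P_{\tau_\ell}\mathbf U_N\mathbf s_N$ be the mean of the observation $\mathbf y\sim\mathcal{CN}(\boldsymbol\mu_{\boldsymbol\theta},\sigma^2\mathbf I_N)$, a function of the real parameters $\boldsymbol\theta=(\tau_\ell,\operatorname{Re}\beta_\ell,\operatorname{Im}\beta_\ell)_{\ell=1}^L\in\mathbb{R}^{3L}$.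 Let $\mathbf J=\mathbf J_N\in\mathbb{R}^{3L\times3L}$ be the (random) Fisher information matrix given the data, $[\mathbf J]_{k,\ell}=\frac{2}{\sigma^2}\operatorname{Re}\{(\partial\boldsymbol\mu/\partial\theta_k)^H(\partial\boldsymbol\mu/\partial\theta_\ell)\}$, let $\bar{\mathbf J}=\mathbb{E}(\mathbf J)$, $\mathbf Z=\bar{\mathbf J}^{-1}(\mathbf J-\bar{\mathbf J})$ and $\Omega_N=\{\|\mathbf Z\|_2<\rho\}$, where $\|\cdot\|_2$ is the spectral norm. Then: (i) with probability one, $\Omega_N$ occurs for all sufficiently large $N$; (ii) for every $N>3L$ such that the delays are pairwise distinct modulo $N$ (which holds for all large $N$), $\bar{\mathbf J}$ is invertible, and $\mathbf J$ is invertible on $\Omega_N$; (iii) consequently, with probability one, $\mathbf J$ is invertible for all sufficiently large $N$. -/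

import Mathlib

open MeasureTheory ProbabilityTheory Filter

noncomputable section

namespace RangingCRB

/-- Index set of the `3L` real parameters of `L` targets: first the delays, then the real parts of
the amplitudes, then the imaginary parts of the amplitudes. -/
abbrev ParamIdx (L : ℕ) : Type := Fin L ⊕ (Fin L ⊕ Fin L)

/-- The parameter vector `θ = [τ, Re β, Im β]`. -/
def paramVec {L : ℕ} (τ : Fin L → ℝ) (β : Fin L → ℂ) : ParamIdx L → ℝ :=
  Sum.elim τ (Sum.elim (fun l => (β l).re) (fun l => (β l).im))

/-- The normalized `N`-point DFT matrix, with entries `N^{-1/2} exp(-2πi m n / N)`, where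
`m, n = 0, …, N - 1`. -/
def dft (N : ℕ) : Matrix (Fin N) (Fin N) ℂ :=
  Matrix.of fun m n =>
    ((1 / Real.sqrt N : ℝ) : ℂ) *
      Complex.exp (-(2 * Real.pi * Complex.I * (m : ℕ) * (n : ℕ) / N))

/-- The periodic (fractional) delay operator `F^H Diag(exp(-2πi n t / N)) F`, for a delay `t`. -/
def periodicDelay (N : ℕ) (t : ℝ) : Matrix (Fin N) (Fin N) ℂ :=
  (dft N).conjTranspose *
    Matrix.diagonal (fun n : Fin N =>
      Complex.exp (-(2 * Real.pi * Complex.I * (n : ℕ) * t / N))) * dft N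

/-- The mean `∑ l, β_l P_{τ_l} U s` of the received vector, as a function of the real parameter
vector `θ`, for modulation matrix `U` and data vector `s`. -/
def echoMean {L N : ℕ} (U : Matrix (Fin N) (Fin N) ℂ) (s : Fin N → ℂ) (θ : ParamIdx L → ℝ) :
    Fin N → ℂ :=
  ∑ l : Fin L,
    ((θ (Sum.inr (Sum.inl l)) : ℂ) + (θ (Sum.inr (Sum.inr l)) : ℂ) * Complex.I) •
      (periodicDelay N (θ (Sum.inl l))).mulVec (U.mulVec s)

/-- The partial derivative of the mean with respect to the `k`-th parameter. -/
def echoMeanDeriv {L N : ℕ} (U : Matrix (Fin N) (Fin N) ℂ) (s : Fin N → ℂ) (θ : ParamIdx L → ℝ)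
    (k : ParamIdx L) : Fin N → ℂ :=
  deriv (fun x : ℝ => echoMean U s (Function.update θ k x)) (θ k)

/-- The Fisher information matrix of the observation `y ∼ CN(μ_θ, σ² I)` at `θ`, given the data
vector `s`: its entries are `(2 / σ²) Re ((∂_k μ)^H (∂_l μ))`. -/
def fim {L N : ℕ} (σ : ℝ) (θ : ParamIdx L → ℝ) (U : Matrix (Fin N) (Fin N) ℂ) (s : Fin N → ℂ) :
    Matrix (ParamIdx L) (ParamIdx L) ℝ :=
  Matrix.of fun k l =>
    2 / σ ^ 2 * (dotProduct (star (echoMeanDeriv U s θ k)) (echoMeanDeriv U s θ l)).re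

/-- The entrywise expectation of a random real matrix. -/
def expectedMatrix {Ω ι : Type*} [MeasurableSpace Ω] (P : Measure Ω) (J : Ω → Matrix ι ι ℝ) :
    Matrix ι ι ℝ :=
  Matrix.of fun k l => ∫ ω, J ω k l ∂P

/-- The spectral norm of a real square matrix: the operator norm for the Euclidean norm. -/
def specNorm {ι : Type*} [Fintype ι] [DecidableEq ι] (A : Matrix ι ι ℝ) : ℝ :=
  ‖Matrix.toEuclideanCLM (n := ι) (𝕜 := ℝ) A‖

/-- The normalized perturbation `Z = J̄⁻¹ (J - J̄)` of a random matrix `J` with mean `J̄`. -/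
def perturbation {Ω ι : Type*} [MeasurableSpace Ω] [Fintype ι] [DecidableEq ι] (P : Measure Ω)
    (J : Ω → Matrix ι ι ℝ) (ω : Ω) : Matrix ι ι ℝ :=
  (expectedMatrix P J)⁻¹ * (J ω - expectedMatrix P J)

/-- The event that the spectral norm of `J̄⁻¹ (J - J̄)` is less than `ρ`. -/
def neumannEvent {Ω ι : Type*} [MeasurableSpace Ω] [Fintype ι] [DecidableEq ι] (P : Measure Ω)
    (J : Ω → Matrix ι ι ℝ) (ρ : ℝ) : Set Ω :=
  {ω | specNorm (perturbation P J ω) < ρ}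

/-- The random Fisher information matrix for block length `N`, when the targets have delays `τ`
and amplitudes `β`, the noise variance is `σ²`, the modulation matrix is `U`, and the data symbols
are the random variables `s n`. -/
def randomFIM {Ω : Type*} {L N : ℕ} (σ : ℝ) (τ : Fin L → ℝ) (β : Fin L → ℂ)
    (U : Matrix (Fin N) (Fin N) ℂ) (s : Fin N → Ω → ℂ) (ω : Ω) :
    Matrix (ParamIdx L) (ParamIdx L) ℝ :=
  fim σ (paramVec τ β) U (fun n => s n ω)

end RangingCRB

end

/-!
The received power at the frequency `n / N` is `|x_n|²`, where `x = F U s`. Since the DFT matrix `F`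
is unitary, each entry of the Fisher information matrix `J` is a real quadratic form
`(2 / σ²) ∑ n, h(n / N) |x_n|²` (`fim_apply`), where `h` is a continuous function on `[0, 1]` that
does not depend on `N`: the real part of a product of two derivatives of the transfer function of
the channel. As `F U` is unitary and the symbols are centred, independent and of unit power, the
mean `J̄` is `2 / σ²` times the Gram matrix of these derivatives on the grid of the frequencies
`n / N` (`expectedMatrix_randomFIM`).

*Invertibility of the mean.* The derivatives sampled on the grid are combinations of the sequences
`z_l ^ n` and `n z_l ^ n` with `z_l = exp(-2πi τ_l / N)`. These are linearly independent for
`N ≥ 2L` and distinct `z_l`, because the confluent Vandermonde system is nonsingular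
(`eq_zero_of_confluent_vandermonde`). Divided by `N`, the Gram matrices are Riemann sums
(`tendsto_sampledGram`) and converge to a Gram matrix in `L²([0, 1])`, which is invertible for the
same reason (`isUnit_limitGram`).

*Concentration.* As nothing is known about the joint distribution for different `N`, summable
deviation probabilities are needed, and the variance `O(N)` of the quadratic form does not provide
them. Its fourth moment does: adding the symbols one at a time, each increment of the quadratic form
is centred given the symbols before it and has a bounded fourth moment, so that the square root of
the fourth moment grows by a bounded amount (`integral_add_pow_four_le`) and the fourth moment is
`O(N²)` (`IsSymbolVector.integral_quadDev_pow_four_le`). Hence `(J - J̄) / N → 0` almost surely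
(`ae_tendsto_randomFIM_sub`).

Together, `Z = (J̄ / N)⁻¹ ((J - J̄) / N) → 0` almost surely. On the event `‖Z‖ < 1`, the matrix
`J = J̄ (1 + Z)` is invertible by the Neumann series.
-/

noncomputable section

namespace RangingCRB

/-! ### Fourth moments of sums with centred increments -/

section Moments

variable {Ω : Type*} [MeasurableSpace Ω] {P : Measure Ω}

lemma memLp_top_mul {𝕜 : Type*} [RCLike 𝕜] {f g : Ω → 𝕜} (hf : MemLp f ⊤ P)
    (hg : MemLp g ⊤ P) : MemLp (fun ω => f ω * g ω) ⊤ P :=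
  hg.mul (p := ⊤) (q := ⊤) (r := ⊤) hf

lemma memLp_top_pow [IsFiniteMeasure P] {f : Ω → ℝ} (hf : MemLp f ⊤ P) (n : ℕ) :
    MemLp (fun ω => f ω ^ n) ⊤ P := by
  induction n with
  | zero => simpa using memLp_const (1 : ℝ)
  | succ n ih => simpa only [pow_succ] using memLp_top_mul ih hf

/-- Cauchy–Schwarz for the squares of two bounded random variables. -/
lemma sq_integral_sq_mul_sq_le [IsFiniteMeasure P] {q d : Ω → ℝ} (hq : MemLp q ⊤ P)
    (hd : MemLp d ⊤ P) :
    (∫ ω, q ω ^ 2 * d ω ^ 2 ∂P) ^ 2 ≤ (∫ ω, q ω ^ 4 ∂P) * ∫ ω, d ω ^ 4 ∂P := by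
  have i1 := (memLp_top_pow hq 4).integrable le_top
  have i2 := (memLp_top_pow hd 4).integrable le_top
  have i3 := (memLp_top_mul (memLp_top_pow hq 2) (memLp_top_pow hd 2)).integrable le_top
  have key : ∀ t : ℝ, 0 ≤ (∫ ω, d ω ^ 4 ∂P) * (t * t) + (-2 * ∫ ω, q ω ^ 2 * d ω ^ 2 ∂P) * t
      + ∫ ω, q ω ^ 4 ∂P := by
    intro t
    have h0 : 0 ≤ ∫ ω, (t * t * d ω ^ 4 + (-2 * t) * (q ω ^ 2 * d ω ^ 2)) + q ω ^ 4 ∂P :=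
      integral_nonneg fun ω => by
        have := sq_nonneg (q ω ^ 2 - t * d ω ^ 2)
        simp only [Pi.zero_apply]
        nlinarith
    rw [integral_add ((i2.const_mul _).fun_add (i3.const_mul _)) i1,
      integral_add (i2.const_mul _) (i3.const_mul _), integral_const_mul, integral_const_mul] at h0
    linarith
  have := discrim_le_zero key
  rw [discrim] at this
  nlinarith

/-- Adding an increment `d` that is orthogonal to `q ^ 3` increases the square root of the fourth
moment by at most four times that of `d`. -/
lemma integral_add_pow_four_le [IsFiniteMeasure P] {q d : Ω → ℝ} (hq : MemLp q ⊤ P)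
    (hd : MemLp d ⊤ P) (horth : ∫ ω, q ω ^ 3 * d ω ∂P = 0) {r v : ℝ} (hr : 0 ≤ r) (hv : 0 ≤ v)
    (hqr : ∫ ω, q ω ^ 4 ∂P ≤ r ^ 2) (hdv : ∫ ω, d ω ^ 4 ∂P ≤ v ^ 2) :
    ∫ ω, (q ω + d ω) ^ 4 ∂P ≤ (r + 4 * v) ^ 2 := by
  have i1 := (memLp_top_pow hq 4).integrable le_top
  have i2 := (memLp_top_pow hd 4).integrable le_top
  have i3 := (memLp_top_mul (memLp_top_pow hq 2) (memLp_top_pow hd 2)).integrable le_top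
  have i4 := (memLp_top_mul (memLp_top_pow hq 3) hd).integrable le_top
  have i5 := (memLp_top_pow (hq.add hd) 4).integrable le_top
  have hcs : ∫ ω, q ω ^ 2 * d ω ^ 2 ∂P ≤ r * v := by
    apply le_of_sq_le_sq _ (by positivity)
    calc _ ≤ _ := sq_integral_sq_mul_sq_le hq hd
      _ ≤ r ^ 2 * v ^ 2 := mul_le_mul hqr hdv (integral_nonneg fun _ => by positivity)
          (by positivity)
      _ = _ := by ring
  calc ∫ ω, (q ω + d ω) ^ 4 ∂P
      ≤ ∫ ω, q ω ^ 4 + 4 * (q ω ^ 3 * d ω) + 8 * (q ω ^ 2 * d ω ^ 2) + 3 * d ω ^ 4 ∂P := by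
        refine integral_mono i5
          (((i1.add (i4.const_mul 4)).add (i3.const_mul 8)).add (i2.const_mul 3)) fun ω => ?_
        -- the only term of unknown sign, `4 * q * d ^ 3`, is absorbed by AM-GM
        have := mul_nonneg (sq_nonneg (d ω)) (sq_nonneg (q ω - d ω))
        simp only
        nlinarith
    _ = ∫ ω, q ω ^ 4 ∂P + 4 * 0 + 8 * ∫ ω, q ω ^ 2 * d ω ^ 2 ∂P + 3 * ∫ ω, d ω ^ 4 ∂P := by
        rw [integral_add ((i1.fun_add (i4.const_mul 4)).fun_add (i3.const_mul 8)) (i2.const_mul 3),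
          integral_add (i1.fun_add (i4.const_mul 4)) (i3.const_mul 8),
          integral_add i1 (i4.const_mul 4), integral_const_mul, integral_const_mul,
          integral_const_mul, horth]
    _ ≤ (r + 4 * v) ^ 2 := by nlinarith

lemma integral_pow_four_le_of_sq_le [IsProbabilityMeasure P] {d : Ω → ℝ} {v : ℝ}
    (hd : ∀ᵐ ω ∂P, d ω ^ 2 ≤ v) : ∫ ω, d ω ^ 4 ∂P ≤ v ^ 2 := by
  calc ∫ ω, d ω ^ 4 ∂P ≤ ∫ _, v ^ 2 ∂P := by
        refine integral_mono_of_nonneg (Eventually.of_forall fun _ => by positivity)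
          (integrable_const _) (hd.mono fun ω h => ?_)
        have : d ω ^ 4 = (d ω ^ 2) ^ 2 := by ring
        simp only [this]
        gcongr
    _ = v ^ 2 := by simp

/-- A Khintchine-type inequality: the fourth moment of a sum of independent centred variables
`X j` with `X j ^ 2 ≤ v j` is at most `16 (∑ v j) ^ 2`. -/
lemma integral_sum_pow_four_le [IsProbabilityMeasure P] {ι : Type*} {X : ι → Ω → ℝ}
    (hX : iIndepFun X P) (hm : ∀ j, AEMeasurable (X j) P) (h0 : ∀ j, ∫ ω, X j ω ∂P = 0)
    {v : ι → ℝ} (hv : ∀ j, ∀ᵐ ω ∂P, X j ω ^ 2 ≤ v j) (hv0 : ∀ j, 0 ≤ v j) (T : Finset ι) :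
    ∫ ω, (∑ j ∈ T, X j ω) ^ 4 ∂P ≤ (4 * ∑ j ∈ T, v j) ^ 2 := by
  classical
  have hL : ∀ j, MemLp (X j) ⊤ P := fun j =>
    memLp_top_of_bound (hm j).aestronglyMeasurable (√(v j))
      ((hv j).mono fun ω h => Real.abs_le_sqrt h)
  induction T using Finset.induction_on with
  | empty => simp
  | insert i T hi ih =>
    have hLT : MemLp (fun ω => ∑ j ∈ T, X j ω) ⊤ P := memLp_finsetSum T fun j _ => hL j
    have hind : IndepFun (fun ω => (∑ j ∈ T, X j ω) ^ 3) (X i) P := by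
      have h := (hX.indepFun_finsetSum_of_notMem₀ hm hi).comp
        (φ := fun x : ℝ => x ^ 3) (ψ := id) (by fun_prop) measurable_id
      simpa [Function.comp_def] using h
    have horth : ∫ ω, (∑ j ∈ T, X j ω) ^ 3 * X i ω ∂P = 0 := by
      rw [hind.integral_fun_mul_eq_mul_integral
        (memLp_top_pow hLT 3).aestronglyMeasurable (hL i).aestronglyMeasurable, h0 i, mul_zero]
    have := integral_add_pow_four_le hLT (hL i) horth
      (mul_nonneg (by norm_num) (Finset.sum_nonneg fun j _ => hv0 j)) (hv0 i) ih
      (integral_pow_four_le_of_sq_le (hv i))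
    simp only [Finset.sum_insert hi]
    calc _ = ∫ ω, (∑ j ∈ T, X j ω + X i ω) ^ 4 ∂P := by simp only [add_comm]
      _ ≤ _ := this
      _ = _ := by ring

end Moments

/-! ### Quadratic forms in independent symbols -/

section Quadratic

variable {Ω : Type*} [MeasurableSpace Ω] {P : Measure Ω} {ι κ : Type*}

/-- A function of the symbols in `T` is independent of every function of a symbol outside `T`. -/
lemma indepFun_comp_of_dependsOn {s : ι → Ω → ℂ} (hs : ∀ i, AEMeasurable (s i) P)
    (hind : iIndepFun s P) {T : Finset ι} {i : ι} (hi : i ∉ T) {E F : Type*} [MeasurableSpace E]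
    [MeasurableSpace F] {Φ : (ι → ℂ) → E} (hΦ : Measurable Φ) (hd : DependsOn Φ (T : Set ι))
    {g : ℂ → F} (hg : Measurable g) :
    IndepFun (fun ω => Φ (fun j => s j ω)) (fun ω => g (s i ω)) P := by
  classical
  -- Extend a vector indexed by `T` by zero; `Φ` does not see the other coordinates.
  let ext : (T → ℂ) → ι → ℂ := fun z j => if h : j ∈ T then z ⟨j, h⟩ else 0
  have hext : Measurable ext := by
    refine measurable_pi_lambda _ fun j => ?_
    by_cases h : j ∈ T
    · simp only [ext, h, dite_true]; exact measurable_pi_apply _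
    · simp only [ext, h, dite_false]; exact measurable_const
  have h := (hind.indepFun_finset₀ T {i} (by simpa using hi) hs).comp
    (φ := fun z => Φ (ext z)) (ψ := fun z : ({i} : Finset ι) → ℂ => g (z ⟨i, by simp⟩))
    (hΦ.comp hext)
    (hg.comp (measurable_pi_apply (⟨i, by simp⟩ : ({i} : Finset ι))))
  refine h.congr (Eventually.of_forall fun ω => ?_) (Eventually.of_forall fun ω => rfl)
  refine hd fun j hj => ?_
  have hj' : j ∈ T := hj
  simp [ext, hj']

/-- The coordinate `n` of `V z`, restricted to the contribution of the symbols in `T`. -/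
def partialCoord (V : Matrix κ ι ℂ) (T : Finset ι) (z : ι → ℂ) (n : κ) : ℂ :=
  ∑ j ∈ T, V n j * z j

/-- The deviation `∑ n, h n (|(V z) n|² - ∑ j, |V n j|²)` of a quadratic form from its mean,
restricted to the contribution of the symbols in `T`. -/
def quadDev [Fintype κ] (h : κ → ℝ) (V : Matrix κ ι ℂ) (T : Finset ι) (z : ι → ℂ) : ℝ :=
  ∑ n, h n * (‖partialCoord V T z n‖ ^ 2 - ∑ j ∈ T, ‖V n j‖ ^ 2)

/-- The sum over `T` of the terms `A i j z j`, where `A = Vᴴ diag(h) V`: the coefficient of the new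
symbol `z i` when it is added to the symbols in `T`. -/
def crossTerm [Fintype κ] (h : κ → ℝ) (V : Matrix κ ι ℂ) (i : ι) (T : Finset ι) (z : ι → ℂ) : ℂ :=
  ∑ j ∈ T, (∑ n, h n * star (V n i) * V n j) * z j

/-- The increment of `quadDev` when the symbol `z i` is added. -/
def quadIncr [Fintype κ] (h : κ → ℝ) (V : Matrix κ ι ℂ) (i : ι) (T : Finset ι) (z : ι → ℂ) : ℝ :=
  2 * ((crossTerm h V i T z).re * (z i).re + (crossTerm h V i T z).im * (z i).im) +
    (∑ n, h n * ‖V n i‖ ^ 2) * (‖z i‖ ^ 2 - 1)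

lemma crossTerm_eq [Fintype κ] (h : κ → ℝ) (V : Matrix κ ι ℂ) (i : ι) (T : Finset ι) (z : ι → ℂ) :
    crossTerm h V i T z = ∑ n, h n * star (V n i) * partialCoord V T z n := by
  simp only [crossTerm, partialCoord, Finset.mul_sum, Finset.sum_mul]
  rw [Finset.sum_comm]
  simp only [mul_assoc]

lemma quadDev_insert [Fintype κ] [DecidableEq ι] (h : κ → ℝ) (V : Matrix κ ι ℂ) {i : ι}
    {T : Finset ι} (hi : i ∉ T) (z : ι → ℂ) :
    quadDev h V (insert i T) z = quadDev h V T z + quadIncr h V i T z := by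
  have hre : (crossTerm h V i T z).re * (z i).re + (crossTerm h V i T z).im * (z i).im =
      ∑ n, h n * (star (V n i * z i) * partialCoord V T z n).re := by
    have : (crossTerm h V i T z).re * (z i).re + (crossTerm h V i T z).im * (z i).im =
        (star (z i) * crossTerm h V i T z).re := by
      simp; ring
    rw [this, crossTerm_eq, Finset.mul_sum, Complex.re_sum]
    refine Finset.sum_congr rfl fun n _ => ?_
    rw [← Complex.re_ofReal_mul]
    congr 1
    simp only [star_mul']
    ring
  rw [quadIncr, hre, quadDev, quadDev, Finset.mul_sum, Finset.sum_mul, ← Finset.sum_add_distrib,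
    ← Finset.sum_add_distrib]
  refine Finset.sum_congr rfl fun n _ => ?_
  simp only [partialCoord, Finset.sum_insert hi]
  set p := ∑ j ∈ T, V n j * z j
  have : ‖V n i * z i + p‖ ^ 2 = ‖V n i‖ ^ 2 * ‖z i‖ ^ 2 + 2 * (star (V n i * z i) * p).re +
      ‖p‖ ^ 2 := by
    rw [← mul_pow, ← norm_mul]
    simp only [← Complex.normSq_eq_norm_sq, Complex.normSq_apply]
    simp
    ring
  rw [this]
  ring

lemma dependsOn_partialCoord (V : Matrix κ ι ℂ) (T : Finset ι) :
    DependsOn (partialCoord V T) (T : Set ι) := by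
  intro x y hxy
  funext n
  exact Finset.sum_congr rfl fun j hj => by rw [hxy j hj]

lemma dependsOn_quadDev [Fintype κ] (h : κ → ℝ) (V : Matrix κ ι ℂ) (T : Finset ι) :
    DependsOn (quadDev h V T) (T : Set ι) := by
  intro x y hxy
  simp only [quadDev, dependsOn_partialCoord V T hxy]

lemma dependsOn_crossTerm [Fintype κ] (h : κ → ℝ) (V : Matrix κ ι ℂ) (i : ι) (T : Finset ι) :
    DependsOn (crossTerm h V i T) (T : Set ι) := by
  intro x y hxy
  simp only [crossTerm_eq, dependsOn_partialCoord V T hxy]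

lemma measurable_quadDev [Fintype κ] (h : κ → ℝ) (V : Matrix κ ι ℂ) (T : Finset ι) :
    Measurable (quadDev h V T) := by
  unfold quadDev partialCoord
  fun_prop

lemma measurable_crossTerm [Fintype κ] (h : κ → ℝ) (V : Matrix κ ι ℂ) (i : ι) (T : Finset ι) :
    Measurable (crossTerm h V i T) := by
  unfold crossTerm
  fun_prop

/-- A family of independent random symbols, centred, of unit power and bounded by `M`. -/
structure IsSymbolVector (P : Measure Ω) (M : ℝ) (s : ι → Ω → ℂ) : Prop where
  aemeasurable : ∀ i, AEMeasurable (s i) P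
  indep : iIndepFun s P
  integral_eq_zero : ∀ i, ∫ ω, s i ω ∂P = 0
  integral_norm_sq : ∀ i, ∫ ω, ‖s i ω‖ ^ 2 ∂P = 1
  norm_le : ∀ i, ∀ᵐ ω ∂P, ‖s i ω‖ ≤ M

namespace IsSymbolVector

variable {M : ℝ} {s : ι → Ω → ℂ}

lemma memLp (hs : IsSymbolVector P M s) (i : ι) : MemLp (s i) ⊤ P :=
  memLp_top_of_bound (hs.aemeasurable i).aestronglyMeasurable M (hs.norm_le i)

lemma memLp_partialCoord (hs : IsSymbolVector P M s) (V : Matrix κ ι ℂ) (T : Finset ι) (n : κ) :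
    MemLp (fun ω => partialCoord V T (fun j => s j ω) n) ⊤ P :=
  memLp_finsetSum T fun j _ => (hs.memLp j).const_mul (V n j)

lemma memLp_crossTerm [Fintype κ] (hs : IsSymbolVector P M s) (h : κ → ℝ) (V : Matrix κ ι ℂ)
    (i : ι) (T : Finset ι) : MemLp (fun ω => crossTerm h V i T (fun j => s j ω)) ⊤ P :=
  memLp_finsetSum T fun j _ => (hs.memLp j).const_mul _

variable [IsProbabilityMeasure P]

lemma memLp_quadDev [Fintype κ] (hs : IsSymbolVector P M s) (h : κ → ℝ) (V : Matrix κ ι ℂ)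
    (T : Finset ι) : MemLp (fun ω => quadDev h V T (fun j => s j ω)) ⊤ P := by
  refine memLp_finsetSum _ fun n _ => MemLp.const_mul ?_ (h n)
  exact (memLp_top_pow (hs.memLp_partialCoord V T n).norm 2).sub (memLp_const _)

lemma memLp_quadIncr [Fintype κ] (hs : IsSymbolVector P M s) (h : κ → ℝ) (V : Matrix κ ι ℂ)
    (i : ι) (T : Finset ι) : MemLp (fun ω => quadIncr h V i T (fun j => s j ω)) ⊤ P := by
  have hY := hs.memLp_crossTerm h V i T
  have h1 : MemLp (fun ω => (crossTerm h V i T fun j => s j ω).re * (s i ω).re) ⊤ P :=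
    memLp_top_mul hY.re (hs.memLp i).re
  have h2 : MemLp (fun ω => (crossTerm h V i T fun j => s j ω).im * (s i ω).im) ⊤ P :=
    memLp_top_mul hY.im (hs.memLp i).im
  have h3 : MemLp (fun ω => ‖s i ω‖ ^ 2) ⊤ P := memLp_top_pow (hs.memLp i).norm 2
  exact ((h1.add h2).const_mul 2).add ((h3.sub (memLp_const 1)).const_mul _)

/-- The increment is orthogonal to every bounded function of the symbols in `T`. -/
lemma integral_mul_quadIncr [Countable ι] [Fintype κ] (hs : IsSymbolVector P M s) (h : κ → ℝ)
    (V : Matrix κ ι ℂ) {i : ι} {T : Finset ι} (hi : i ∉ T) {W : (ι → ℂ) → ℝ} (hW : Measurable W)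
    (hWd : DependsOn W (T : Set ι)) (hWL : MemLp (fun ω => W (fun j => s j ω)) ⊤ P) :
    ∫ ω, W (fun j => s j ω) * quadIncr h V i T (fun j => s j ω) ∂P = 0 := by
  have hY := hs.memLp_crossTerm h V i T
  have hYm := measurable_crossTerm h V i T
  have hYd := dependsOn_crossTerm h V i T
  have hint : Integrable (s i) P := (hs.memLp i).integrable le_top
  have hre : ∫ ω, (s i ω).re ∂P = 0 := by
    have := integral_re hint
    simp only [RCLike.re_to_complex] at this
    rw [this, hs.integral_eq_zero i, Complex.zero_re]
  have him : ∫ ω, (s i ω).im ∂P = 0 := by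
    have := integral_im hint
    simp only [RCLike.im_to_complex] at this
    rw [this, hs.integral_eq_zero i, Complex.zero_im]
  have hsq : ∫ ω, (‖s i ω‖ ^ 2 - 1) ∂P = 0 := by
    rw [integral_sub ((memLp_top_pow (hs.memLp i).norm 2).integrable le_top)
      (integrable_const _), hs.integral_norm_sq i]
    simp
  have factor : ∀ (Φ : (ι → ℂ) → ℝ) (g : ℂ → ℝ), Measurable Φ → DependsOn Φ (T : Set ι) →
      Measurable g → ∫ ω, g (s i ω) ∂P = 0 →
      ∫ ω, Φ (fun j => s j ω) * g (s i ω) ∂P = 0 := by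
    intro Φ g hΦ hΦd hg h0
    have hvec : AEMeasurable (fun ω => fun j => s j ω) P :=
      aemeasurable_pi_lambda _ hs.aemeasurable
    rw [(indepFun_comp_of_dependsOn hs.aemeasurable hs.indep hi hΦ hΦd hg
      ).integral_fun_mul_eq_mul_integral (hΦ.comp_aemeasurable hvec).aestronglyMeasurable
      (hg.comp_aemeasurable (hs.aemeasurable i)).aestronglyMeasurable, h0, mul_zero]
  have f1 := factor (fun z => W z * (crossTerm h V i T z).re) Complex.re
    (by fun_prop) (fun x y hxy => by simp only [hWd hxy, hYd hxy]) (by fun_prop) hre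
  have f2 := factor (fun z => W z * (crossTerm h V i T z).im) Complex.im
    (by fun_prop) (fun x y hxy => by simp only [hWd hxy, hYd hxy]) (by fun_prop) him
  have f3 := factor W (fun z => ‖z‖ ^ 2 - 1) hW hWd (by fun_prop) hsq
  have i1 := (memLp_top_mul (memLp_top_mul hWL hY.re) (hs.memLp i).re).integrable le_top
  have i2 := (memLp_top_mul (memLp_top_mul hWL hY.im) (hs.memLp i).im).integrable le_top
  have i3 := (memLp_top_mul hWL ((memLp_top_pow (hs.memLp i).norm 2).sub
    (memLp_const (1 : ℝ)))).integrable le_top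
  simp only [RCLike.re_to_complex, RCLike.im_to_complex, Pi.sub_apply] at i1 i2 i3
  calc _ = ∫ ω, (2 * (W (fun j => s j ω) * (crossTerm h V i T (fun j => s j ω)).re * (s i ω).re) +
        2 * (W (fun j => s j ω) * (crossTerm h V i T (fun j => s j ω)).im * (s i ω).im)) +
        (∑ n, h n * ‖V n i‖ ^ 2) * (W (fun j => s j ω) * (‖s i ω‖ ^ 2 - 1)) ∂P := by
        refine integral_congr_ae (Eventually.of_forall fun ω => ?_)
        simp only [quadIncr]
        ring
    _ = 0 := by
        rw [integral_add ((i1.const_mul 2).fun_add (i2.const_mul 2)) (i3.const_mul _),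
          integral_add (i1.const_mul 2) (i2.const_mul 2), integral_const_mul, integral_const_mul,
          integral_const_mul, f1, f2, f3]
        simp

lemma integral_quadDev [Countable ι] [Fintype κ] (hs : IsSymbolVector P M s) (h : κ → ℝ)
    (V : Matrix κ ι ℂ) (T : Finset ι) : ∫ ω, quadDev h V T (fun j => s j ω) ∂P = 0 := by
  classical
  induction T using Finset.induction_on with
  | empty => simp [quadDev, partialCoord]
  | insert i T hi ih =>
    simp only [quadDev_insert h V hi]
    rw [integral_add ((hs.memLp_quadDev h V T).integrable le_top)
      ((hs.memLp_quadIncr h V i T).integrable le_top), ih]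
    have := hs.integral_mul_quadIncr h V hi (W := fun _ => 1) measurable_const
      (fun _ _ _ => rfl) (memLp_const _)
    simpa using this

lemma integral_norm_sum_pow_four_le (hs : IsSymbolVector P M s) (c : ι → ℂ)
    (T : Finset ι) :
    ∫ ω, ‖∑ j ∈ T, c j * s j ω‖ ^ 4 ∂P ≤ 64 * M ^ 4 * (∑ j ∈ T, ‖c j‖ ^ 2) ^ 2 := by
  have hL : ∀ j, MemLp (fun ω => c j * s j ω) ⊤ P := fun j => (hs.memLp j).const_mul _
  have hI : ∀ j, ∫ ω, c j * s j ω ∂P = 0 := fun j => by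
    rw [integral_const_mul, hs.integral_eq_zero, mul_zero]
  have hsqle : ∀ j, ∀ᵐ ω ∂P, ‖c j * s j ω‖ ^ 2 ≤ M ^ 2 * ‖c j‖ ^ 2 := fun j =>
    (hs.norm_le j).mono fun ω h => by
      rw [norm_mul, mul_pow, mul_comm]
      gcongr
  have e : ∀ ω, ∑ j ∈ T, (c j * s j ω).re = (∑ j ∈ T, c j * s j ω).re := fun ω => by simp
  have e' : ∀ ω, ∑ j ∈ T, (c j * s j ω).im = (∑ j ∈ T, c j * s j ω).im := fun ω => by simp
  have b1 := integral_sum_pow_four_le (P := P) (X := fun j ω => (c j * s j ω).re)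
    (v := fun j => M ^ 2 * ‖c j‖ ^ 2)
    (hs.indep.comp (fun j z => (c j * z).re) (fun j => by fun_prop))
    (fun j => (hL j).re.aestronglyMeasurable.aemeasurable)
    (fun j => by
      have := integral_re ((hL j).integrable le_top)
      simp only [RCLike.re_to_complex] at this
      rw [this, hI, Complex.zero_re])
    (fun j => (hsqle j).mono fun ω h => le_trans (by
      rw [← Complex.normSq_eq_norm_sq, Complex.normSq_apply]
      nlinarith [sq_nonneg (c j * s j ω).im]) h)
    (fun j => by positivity) T
  have b2 := integral_sum_pow_four_le (P := P) (X := fun j ω => (c j * s j ω).im)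
    (v := fun j => M ^ 2 * ‖c j‖ ^ 2)
    (hs.indep.comp (fun j z => (c j * z).im) (fun j => by fun_prop))
    (fun j => (hL j).im.aestronglyMeasurable.aemeasurable)
    (fun j => by
      have := integral_im ((hL j).integrable le_top)
      simp only [RCLike.im_to_complex] at this
      rw [this, hI, Complex.zero_im])
    (fun j => (hsqle j).mono fun ω h => le_trans (by
      rw [← Complex.normSq_eq_norm_sq, Complex.normSq_apply]
      nlinarith [sq_nonneg (c j * s j ω).re]) h)
    (fun j => by positivity) T
  simp only [e, e', ← Finset.mul_sum] at b1 b2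
  have hS : MemLp (fun ω => ∑ j ∈ T, c j * s j ω) ⊤ P := memLp_finsetSum T fun j _ => hL j
  have j1 := (memLp_top_pow hS.re 4).integrable le_top
  have j2 := (memLp_top_pow hS.im 4).integrable le_top
  simp only [RCLike.re_to_complex, RCLike.im_to_complex] at j1 j2
  calc _ ≤ ∫ ω, 2 * (∑ j ∈ T, c j * s j ω).re ^ 4 + 2 * (∑ j ∈ T, c j * s j ω).im ^ 4 ∂P := by
        refine integral_mono ((memLp_top_pow hS.norm 4).integrable le_top)
          ((j1.const_mul 2).add (j2.const_mul 2)) fun ω => ?_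
        have : ∀ w : ℂ, ‖w‖ ^ 4 ≤ 2 * w.re ^ 4 + 2 * w.im ^ 4 := fun w => by
          have : ‖w‖ ^ 4 = (‖w‖ ^ 2) ^ 2 := by ring
          rw [this, ← Complex.normSq_eq_norm_sq, Complex.normSq_apply]
          nlinarith [sq_nonneg (w.re ^ 2 - w.im ^ 2)]
        exact this _
    _ ≤ 2 * (4 * (M ^ 2 * ∑ j ∈ T, ‖c j‖ ^ 2)) ^ 2 +
        2 * (4 * (M ^ 2 * ∑ j ∈ T, ‖c j‖ ^ 2)) ^ 2 := by
        rw [integral_add (j1.const_mul 2) (j2.const_mul 2), integral_const_mul, integral_const_mul]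
        gcongr
    _ = _ := by ring

/-- The increment is dominated by `2 M ‖Y‖ + H M ^ 2`, where `Y` is the cross term. -/
lemma integral_quadIncr_pow_four_le [Fintype κ] (hs : IsSymbolVector P M s) (hM : 1 ≤ M)
    (h : κ → ℝ) (V : Matrix κ ι ℂ) {i : ι} {T : Finset ι} {H : ℝ} (hH : 0 ≤ H)
    (hdiag : |∑ n, h n * ‖V n i‖ ^ 2| ≤ H)
    (hrow : ∑ j ∈ T, ‖∑ n, h n * star (V n i) * V n j‖ ^ 2 ≤ H ^ 2) :
    ∫ ω, quadIncr h V i T (fun j => s j ω) ^ 4 ∂P ≤ (92 * H ^ 2 * M ^ 4) ^ 2 := by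
  have hY := hs.memLp_crossTerm h V i T
  have iY := (memLp_top_pow hY.norm 4).integrable le_top
  have hYb : ∫ ω, ‖crossTerm h V i T (fun j => s j ω)‖ ^ 4 ∂P ≤ 64 * M ^ 4 * (H ^ 2) ^ 2 :=
    (hs.integral_norm_sum_pow_four_le _ T).trans (by gcongr)
  calc _ ≤ ∫ ω, 128 * M ^ 4 * ‖crossTerm h V i T (fun j => s j ω)‖ ^ 4 +
        128 * H ^ 4 * M ^ 8 ∂P := by
        refine integral_mono_ae ((memLp_top_pow (hs.memLp_quadIncr h V i T) 4).integrable le_top)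
          ((iY.const_mul _).fun_add (integrable_const _)) ((hs.norm_le i).mono fun ω hω => ?_)
        set Y := crossTerm h V i T (fun j => s j ω)
        set z := s i ω
        have hre : |Y.re * z.re + Y.im * z.im| ≤ ‖Y‖ * M := by
          have : Y.re * z.re + Y.im * z.im = (star Y * z).re := by simp
          rw [this]
          refine (Complex.abs_re_le_norm _).trans ?_
          rw [norm_mul, norm_star]
          gcongr
        have hz : |‖z‖ ^ 2 - 1| ≤ M ^ 2 := by
          rw [abs_le]
          constructor <;> nlinarith [norm_nonneg z]
        have hd : |quadIncr h V i T (fun j => s j ω)| ≤ 2 * (‖Y‖ * M) + H * M ^ 2 := by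
          refine (abs_add_le _ _).trans ?_
          rw [abs_mul, abs_mul, abs_two]
          gcongr
        have h4 : quadIncr h V i T (fun j => s j ω) ^ 4 ≤ (2 * (‖Y‖ * M) + H * M ^ 2) ^ 4 := by
          rw [← Even.pow_abs (by decide : Even 4)]
          gcongr
        refine h4.trans ((add_pow_le (by positivity) (by positivity) 4).trans ?_)
        have : 0 ≤ H ^ 4 * M ^ 8 := by positivity
        simp only
        ring_nf
        nlinarith
    _ = 128 * M ^ 4 * ∫ ω, ‖crossTerm h V i T (fun j => s j ω)‖ ^ 4 ∂P + 128 * H ^ 4 * M ^ 8 := by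
        rw [integral_add (iY.const_mul _) (integrable_const _), integral_const_mul]
        simp
    _ ≤ 128 * M ^ 4 * (64 * M ^ 4 * (H ^ 2) ^ 2) + 128 * H ^ 4 * M ^ 8 := by gcongr
    _ ≤ _ := by
        -- `128 * 64 + 128 = 8320 ≤ 92 ^ 2`
        have : 0 ≤ H ^ 4 * M ^ 8 := by positivity
        nlinarith

/-- The centred quadratic form has a fourth moment of order `|T| ^ 2` if the diagonal entries of
the matrix `A = Vᴴ diag(h) V` and the Euclidean norms of its rows are bounded. -/
lemma integral_quadDev_pow_four_le [Countable ι] [Fintype κ] (hs : IsSymbolVector P M s)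
    (hM : 1 ≤ M) (h : κ → ℝ) (V : Matrix κ ι ℂ) {H : ℝ} (hH : 0 ≤ H)
    (hdiag : ∀ i, |∑ n, h n * ‖V n i‖ ^ 2| ≤ H)
    (hrow : ∀ i, ∀ T : Finset ι, ∑ j ∈ T, ‖∑ n, h n * star (V n i) * V n j‖ ^ 2 ≤ H ^ 2)
    (T : Finset ι) :
    ∫ ω, quadDev h V T (fun j => s j ω) ^ 4 ∂P ≤ (368 * H ^ 2 * M ^ 4 * T.card) ^ 2 := by
  classical
  induction T using Finset.induction_on with
  | empty => simp [quadDev, partialCoord]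
  | insert i T hi ih =>
    simp only [quadDev_insert h V hi]
    have horth := hs.integral_mul_quadIncr h V hi (W := fun z => quadDev h V T z ^ 3)
      ((measurable_quadDev h V T).pow_const 3)
      (fun _ _ hxy => by simp only [dependsOn_quadDev h V T hxy])
      (memLp_top_pow (hs.memLp_quadDev h V T) 3)
    refine (integral_add_pow_four_le (hs.memLp_quadDev h V T) (hs.memLp_quadIncr h V i T) horth
      (by positivity) (by positivity) ih
      (hs.integral_quadIncr_pow_four_le hM h V hH (hdiag i) (hrow i T))).trans (le_of_eq ?_)
    rw [Finset.card_insert_of_notMem hi]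
    push_cast
    ring

end IsSymbolVector

end Quadratic

/-! ### Quadratic forms diagonalized by a unitary matrix -/

section Unitary

open Matrix

variable {ι : Type*} [Fintype ι]

lemma ofReal_sum_norm_sq (x : ι → ℂ) : ((∑ j, ‖x j‖ ^ 2 : ℝ) : ℂ) = x ⬝ᵥ star x := by
  simp [dotProduct, Complex.mul_conj, Complex.normSq_eq_norm_sq]

variable [DecidableEq ι]

lemma sum_norm_sq_vecMul_unitary {V : Matrix ι ι ℂ} (hV : V ∈ unitaryGroup ι ℂ) (w : ι → ℂ) :
    ∑ j, ‖(w ᵥ* V) j‖ ^ 2 = ∑ j, ‖w j‖ ^ 2 := by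
  have h : V * Vᴴ = 1 := by
    rw [← star_eq_conjTranspose]; exact mem_unitaryGroup_iff.1 hV
  apply Complex.ofReal_injective
  rw [ofReal_sum_norm_sq, ofReal_sum_norm_sq, star_vecMul, ← dotProduct_mulVec, mulVec_mulVec, h,
    one_mulVec]

lemma sum_norm_sq_row {V : Matrix ι ι ℂ} (hV : V ∈ unitaryGroup ι ℂ) (n : ι) :
    ∑ j, ‖V n j‖ ^ 2 = 1 := by
  have := sum_norm_sq_vecMul_unitary hV (Pi.single n 1)
  simpa [single_one_vecMul, Pi.single_apply, apply_ite] using this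

lemma sum_norm_sq_col {V : Matrix ι ι ℂ} (hV : V ∈ unitaryGroup ι ℂ) (i : ι) :
    ∑ n, ‖V n i‖ ^ 2 = 1 := by
  have h : star V ∈ unitaryGroup ι ℂ := Unitary.star_mem hV
  simpa [star_apply] using sum_norm_sq_row h i

variable {Ω : Type*} [MeasurableSpace Ω] {P : Measure Ω} [IsProbabilityMeasure P] {M : ℝ}
  {s : ι → Ω → ℂ}

/-- The rows of a unitary matrix have unit norm, so the quadratic form is centred by `∑ n, h n`. -/
lemma quadDev_unitary {V : Matrix ι ι ℂ} (hV : V ∈ unitaryGroup ι ℂ) (h : ι → ℝ) (z : ι → ℂ) :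
    quadDev h V Finset.univ z = ∑ n, h n * ‖(V *ᵥ z) n‖ ^ 2 - ∑ n, h n := by
  simp only [quadDev, sum_norm_sq_row hV, mul_sub, mul_one, Finset.sum_sub_distrib]
  rfl

lemma IsSymbolVector.integral_quadForm_unitary (hs : IsSymbolVector P M s) {V : Matrix ι ι ℂ}
    (hV : V ∈ unitaryGroup ι ℂ) (h : ι → ℝ) :
    ∫ ω, ∑ n, h n * ‖(V *ᵥ fun j => s j ω) n‖ ^ 2 ∂P = ∑ n, h n := by
  have h0 := hs.integral_quadDev h V Finset.univ
  have hi : Integrable (fun ω => quadDev h V Finset.univ fun j => s j ω) P :=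
    (hs.memLp_quadDev h V Finset.univ).integrable le_top
  have e : ∀ ω, ∑ n, h n * ‖(V *ᵥ fun j => s j ω) n‖ ^ 2 =
      quadDev h V Finset.univ (fun j => s j ω) + ∑ n, h n := fun ω => by
    rw [quadDev_unitary hV, sub_add_cancel]
  simp only [e]
  rw [integral_add hi (integrable_const _), h0]
  simp

/-- The diagonal entries and the Euclidean norms of the rows of `Vᴴ diag(h) V` are at most
`max |h n|`, whatever the unitary matrix `V`. -/
lemma IsSymbolVector.integral_quadDev_unitary_pow_four_le (hs : IsSymbolVector P M s)
    (hM : 1 ≤ M) {V : Matrix ι ι ℂ} (hV : V ∈ unitaryGroup ι ℂ) {h : ι → ℝ} {H : ℝ} (hH : 0 ≤ H)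
    (hh : ∀ n, |h n| ≤ H) :
    ∫ ω, quadDev h V Finset.univ (fun j => s j ω) ^ 4 ∂P ≤
      (368 * H ^ 2 * M ^ 4 * Fintype.card ι) ^ 2 := by
  refine hs.integral_quadDev_pow_four_le hM h V hH (fun i => ?_) (fun i T => ?_) Finset.univ
  · calc |∑ n, h n * ‖V n i‖ ^ 2| ≤ ∑ n, H * ‖V n i‖ ^ 2 := by
          refine (Finset.abs_sum_le_sum_abs _ _).trans (Finset.sum_le_sum fun n _ => ?_)
          rw [abs_mul, abs_of_nonneg (sq_nonneg ‖V n i‖)]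
          exact mul_le_mul_of_nonneg_right (hh n) (by positivity)
      _ = H := by rw [← Finset.mul_sum, sum_norm_sq_col hV, mul_one]
  · have e : ∀ j, ∑ n, h n * star (V n i) * V n j = ((fun n => h n * star (V n i)) ᵥ* V) j :=
      fun j => rfl
    calc _ ≤ ∑ j, ‖∑ n, h n * star (V n i) * V n j‖ ^ 2 :=
          Finset.sum_le_sum_of_subset_of_nonneg (Finset.subset_univ T) fun _ _ _ => by positivity
      _ = ∑ n, ‖(h n : ℂ) * star (V n i)‖ ^ 2 := by
          simp only [e]; exact sum_norm_sq_vecMul_unitary hV _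
      _ ≤ ∑ n, H ^ 2 * ‖V n i‖ ^ 2 := by
          refine Finset.sum_le_sum fun n _ => ?_
          rw [norm_mul, norm_star, mul_pow, Complex.norm_real, Real.norm_eq_abs]
          have := hh n
          gcongr
      _ = H ^ 2 := by rw [← Finset.mul_sum, sum_norm_sq_col hV, mul_one]

end Unitary

/-! ### The Fisher information matrix in the frequency domain -/

section Spectrum

open Matrix

lemma dft_mul_conjTranspose (N : ℕ) : dft N * (dft N)ᴴ = 1 := by
  ext m m'
  have hN : (N : ℂ) ≠ 0 := by
    have := m.pos
    exact_mod_cast this.ne'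
  have hsq : ((1 / √(N : ℝ) : ℝ) : ℂ) * ((1 / √(N : ℝ) : ℝ) : ℂ) = (N : ℂ)⁻¹ := by
    rw [← Complex.ofReal_mul, div_mul_div_comm, Real.mul_self_sqrt (Nat.cast_nonneg N)]
    push_cast
    ring
  -- The entry `(m, m')` is a geometric sum with ratio the `N`-th root of unity `ζ`.
  set ζ : ℂ := Complex.exp (2 * Real.pi * Complex.I * ((m' : ℕ) - (m : ℕ) : ℂ) / N) with hζ
  have hterm : ∀ n : Fin N, dft N m n * (dft N)ᴴ n m' = (N : ℂ)⁻¹ * ζ ^ (n : ℕ) := by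
    intro n
    simp only [dft, conjTranspose_apply, of_apply, star_mul', RCLike.star_def, Complex.conj_ofReal,
      ← Complex.exp_conj]
    rw [mul_mul_mul_comm, hsq, ← Complex.exp_add, hζ, ← Complex.exp_nat_mul]
    congr 2
    simp only [map_neg, map_div₀, map_mul, Complex.conj_ofReal, Complex.conj_I, map_natCast,
      map_ofNat]
    field_simp
    ring
  rw [mul_apply, Finset.sum_congr rfl fun n _ => hterm n, ← Finset.mul_sum,
    Fin.sum_univ_eq_sum_range (fun n => ζ ^ n)]
  by_cases h : m = m'
  · subst h
    have : ζ = 1 := by simp [hζ]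
    simp [this, hN]
  · have hζN : ζ ^ N = 1 := by
      rw [hζ, ← Complex.exp_nat_mul, Complex.exp_eq_one_iff]
      refine ⟨(m' : ℤ) - (m : ℤ), ?_⟩
      push_cast
      field_simp
    have hζ1 : ζ ≠ 1 := by
      intro h1
      rw [hζ, Complex.exp_eq_one_iff] at h1
      obtain ⟨k, hk⟩ := h1
      have hpi : (2 * Real.pi * Complex.I : ℂ) ≠ 0 := Complex.two_pi_I_ne_zero
      have hk' : ((m' : ℕ) - (m : ℕ) : ℂ) = k * N := by
        field_simp at hk
        linear_combination hk
      have hk2 : ((m' : ℕ) : ℤ) - ((m : ℕ) : ℤ) = k * N := by exact_mod_cast hk'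
      have hm := m.isLt
      have hm' := m'.isLt
      have hlt : |((m' : ℕ) : ℤ) - ((m : ℕ) : ℤ)| < N := by rw [abs_lt]; omega
      have h0 := Int.eq_zero_of_abs_lt_dvd (Dvd.intro_left k hk2.symm) hlt
      exact h (Fin.ext (by omega))
    rw [geom_sum_eq hζ1, hζN, one_apply_ne h]
    simp

lemma dft_mem_unitaryGroup (N : ℕ) : dft N ∈ unitaryGroup (Fin N) ℂ :=
  mem_unitaryGroup_iff.2 (by rw [star_eq_conjTranspose, dft_mul_conjTranspose])

/-- The transfer function `∑ l, b_l exp(-2πi x t_l)` of the channel at the normalized frequency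
`x`, for the parameters `θ = (t, Re b, Im b)`. -/
def transfer {L : ℕ} (θ : ParamIdx L → ℝ) (x : ℝ) : ℂ :=
  ∑ l : Fin L, ((θ (Sum.inr (Sum.inl l)) : ℂ) + (θ (Sum.inr (Sum.inr l)) : ℂ) * Complex.I) *
    Complex.exp (-(2 * Real.pi * Complex.I * x * θ (Sum.inl l)))

/-- The partial derivative of the transfer function with respect to the parameter `k`. -/
def transferGrad {L : ℕ} (τ : Fin L → ℝ) (β : Fin L → ℂ) (k : ParamIdx L) (x : ℝ) : ℂ :=
  Sum.elim
    (fun l => -(2 * Real.pi * Complex.I * x) * β l *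
      Complex.exp (-(2 * Real.pi * Complex.I * x * τ l)))
    (Sum.elim (fun l => Complex.exp (-(2 * Real.pi * Complex.I * x * τ l)))
      (fun l => Complex.I * Complex.exp (-(2 * Real.pi * Complex.I * x * τ l)))) k

lemma hasDerivAt_transfer {L : ℕ} (τ : Fin L → ℝ) (β : Fin L → ℂ) (k : ParamIdx L) (x : ℝ) :
    HasDerivAt (fun t : ℝ => transfer (Function.update (paramVec τ β) k t) x)
      (transferGrad τ β k x) (paramVec τ β k) := by
  have hβ : ∀ l, ((β l).re : ℂ) + (β l).im * Complex.I = β l := fun l => Complex.re_add_im _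
  have hid : ∀ a : ℝ, HasDerivAt (fun t : ℝ => (t : ℂ)) 1 a := fun a => by
    simpa using (hasDerivAt_id a).ofReal_comp
  -- Only the summand `l₀` depends on the parameter that varies.
  have key : ∀ l₀ : Fin L, ∀ (f : Fin L → ℝ → ℂ) (f' : ℂ) (a : ℝ), HasDerivAt (f l₀) f' a →
      (∀ l ≠ l₀, ∃ c, f l = fun _ => c) → HasDerivAt (fun t => ∑ l, f l t) f' a := by
    intro l₀ f f' a h1 h2
    have : HasDerivAt (fun t => ∑ l, f l t) (∑ l, if l = l₀ then f' else 0) a := by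
      refine HasDerivAt.fun_sum fun l _ => ?_
      by_cases h : l = l₀
      · simpa [h] using h1
      · obtain ⟨c, hc⟩ := h2 l h
        simpa [h, hc] using hasDerivAt_const a c
    simpa using this
  rcases k with l₀ | l₀ | l₀
  · refine key l₀ _ _ _ ?_ fun l hl => ?_
    · simp only [Function.update_self, Function.update_of_ne, ne_eq, reduceCtorEq,
        not_false_eq_true, paramVec, Sum.elim_inl, Sum.elim_inr, hβ, transferGrad]
      have h := (((hid (τ l₀)).const_mul (2 * Real.pi * Complex.I * x)).neg.cexp).const_mul (β l₀)
      exact h.congr_deriv (by simp only [Pi.neg_apply]; ring)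
    · refine ⟨β l * Complex.exp (-(2 * Real.pi * Complex.I * x * τ l)), ?_⟩
      funext t
      have : (Sum.inl l : ParamIdx L) ≠ Sum.inl l₀ := by simpa using hl
      simp [Function.update_of_ne this, paramVec, hβ]
  · refine key l₀ _ _ _ ?_ fun l hl => ?_
    · simp only [Function.update_self, Function.update_of_ne, ne_eq, reduceCtorEq, Sum.inr.injEq,
        not_false_eq_true, paramVec, Sum.elim_inl, Sum.elim_inr, transferGrad]
      have h := ((hid (β l₀).re).add_const (((β l₀).im : ℂ) * Complex.I)).mul_const
        (Complex.exp (-(2 * Real.pi * Complex.I * x * τ l₀)))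
      simpa using h
    · refine ⟨β l * Complex.exp (-(2 * Real.pi * Complex.I * x * τ l)), ?_⟩
      funext t
      have : (Sum.inr (Sum.inl l) : ParamIdx L) ≠ Sum.inr (Sum.inl l₀) := by simpa using hl
      simp [Function.update_of_ne this, paramVec, hβ]
  · refine key l₀ _ _ _ ?_ fun l hl => ?_
    · simp only [Function.update_self, Function.update_of_ne, ne_eq, reduceCtorEq, Sum.inr.injEq,
        not_false_eq_true, paramVec, Sum.elim_inl, Sum.elim_inr, transferGrad]
      have h := (((hid (β l₀).im).mul_const Complex.I).const_add ((β l₀).re : ℂ)).mul_const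
        (Complex.exp (-(2 * Real.pi * Complex.I * x * τ l₀)))
      simpa using h
    · refine ⟨β l * Complex.exp (-(2 * Real.pi * Complex.I * x * τ l)), ?_⟩
      funext t
      have : (Sum.inr (Sum.inr l) : ParamIdx L) ≠ Sum.inr (Sum.inr l₀) := by simpa using hl
      simp [Function.update_of_ne this, paramVec, hβ]

lemma echoMean_eq {L N : ℕ} (U : Matrix (Fin N) (Fin N) ℂ) (s : Fin N → ℂ) (θ : ParamIdx L → ℝ) :
    echoMean U s θ =
      (dft N)ᴴ *ᵥ fun n => transfer θ ((n : ℕ) / N) * ((dft N * U) *ᵥ s) n := by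
  have h : ∀ t : ℝ, periodicDelay N t *ᵥ (U *ᵥ s) = (dft N)ᴴ *ᵥ fun n =>
      Complex.exp (-(2 * Real.pi * Complex.I * (n : ℕ) * t / N)) * ((dft N * U) *ᵥ s) n := by
    intro t
    rw [periodicDelay, ← mulVec_mulVec, ← mulVec_mulVec, mulVec_mulVec _ (dft N) U]
    congr 1
    funext n
    rw [mulVec_diagonal]
  simp only [echoMean, h, ← mulVec_smul, ← mulVec_sum]
  congr 1
  funext n
  simp only [Finset.sum_apply, Pi.smul_apply, smul_eq_mul, transfer, Finset.sum_mul]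
  refine Finset.sum_congr rfl fun l _ => ?_
  rw [← mul_assoc]
  congr 3
  push_cast
  ring

lemma echoMeanDeriv_eq {L N : ℕ} (U : Matrix (Fin N) (Fin N) ℂ) (s : Fin N → ℂ) (τ : Fin L → ℝ)
    (β : Fin L → ℂ) (k : ParamIdx L) :
    echoMeanDeriv U s (paramVec τ β) k =
      (dft N)ᴴ *ᵥ fun n => transferGrad τ β k ((n : ℕ) / N) * ((dft N * U) *ᵥ s) n := by
  refine HasDerivAt.deriv ?_
  simp only [echoMean_eq]
  rw [hasDerivAt_pi]
  intro m
  simp only [mulVec, dotProduct]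
  exact HasDerivAt.fun_sum fun n _ => ((hasDerivAt_transfer τ β k _).mul_const _).const_mul _

/-- The weight `Re (conj (∂_k H) (∂_l H))` of the received power at frequency `x` in the
entry `(k, l)` of the Fisher information matrix, where `H` is the transfer function. -/
def fimWeight {L : ℕ} (τ : Fin L → ℝ) (β : Fin L → ℂ) (k l : ParamIdx L) (x : ℝ) : ℝ :=
  (star (transferGrad τ β k x) * transferGrad τ β l x).re

/-- Since the DFT is unitary, the entries of the Fisher information matrix are real quadratic forms
in the data, which are diagonal in the frequency domain. -/
lemma fim_apply {L N : ℕ} (σ : ℝ) (U : Matrix (Fin N) (Fin N) ℂ) (s : Fin N → ℂ) (τ : Fin L → ℝ)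
    (β : Fin L → ℂ) (k l : ParamIdx L) :
    fim σ (paramVec τ β) U s k l = 2 / σ ^ 2 *
      ∑ n : Fin N, fimWeight τ β k l ((n : ℕ) / N) * ‖((dft N * U) *ᵥ s) n‖ ^ 2 := by
  simp only [fim, of_apply, echoMeanDeriv_eq]
  congr 1
  rw [star_mulVec, conjTranspose_conjTranspose, ← dotProduct_mulVec, mulVec_mulVec,
    dft_mul_conjTranspose, one_mulVec, dotProduct, Complex.re_sum]
  refine Finset.sum_congr rfl fun n _ => ?_
  simp only [fimWeight, Pi.star_apply, star_mul']
  set y := ((dft N * U) *ᵥ s) n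
  set a := transferGrad τ β k ((n : ℕ) / N)
  set b := transferGrad τ β l ((n : ℕ) / N)
  have : star a * star y * (b * y) = star a * b * ((‖y‖ ^ 2 : ℝ) : ℂ) := by
    rw [← Complex.normSq_eq_norm_sq, ← Complex.mul_conj]
    simp only [RCLike.star_def]
    ring
  rw [this, Complex.re_mul_ofReal]

end Spectrum

/-! ### Linear independence of the parameter derivatives -/

section Independence

open Polynomial

/-- The confluent Vandermonde system with distinct non-zero nodes `z l`, each of multiplicity two,
is nonsingular: the sequences `z l ^ n` and `n * z l ^ n`, for `n < N`, are linearly independent as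
soon as `N` is at least twice the number of nodes. -/
lemma eq_zero_of_confluent_vandermonde {ι : Type*} [Fintype ι] {z : ι → ℂ}
    (hz : Function.Injective z) (hz0 : ∀ l, z l ≠ 0) {a b : ι → ℂ} {N : ℕ}
    (hN : 2 * Fintype.card ι ≤ N) (h : ∀ n < N, ∑ l, (a l + b l * n) * z l ^ n = 0) :
    a = 0 ∧ b = 0 := by
  classical
  -- By linearity, the system says that a functional vanishes on all polynomials of degree `< N`.
  have hpoly : ∀ p : ℂ[X], p.natDegree < N →
      ∑ l, (a l * p.eval (z l) + b l * (z l * (derivative p).eval (z l))) = 0 := by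
    intro p hp
    have e1 : ∀ x, p.eval x = ∑ n ∈ Finset.range N, p.coeff n * x ^ n := fun x =>
      eval_eq_sum_range' hp x
    have hdeg : (X * derivative p).natDegree < N := by
      rcases Nat.eq_zero_or_pos p.natDegree with h0 | h0
      · rw [derivative_of_natDegree_zero h0]
        simpa using (Nat.zero_le _).trans_lt hp
      · refine (natDegree_mul_le.trans ?_).trans_lt hp
        have := natDegree_derivative_lt h0.ne'
        have := natDegree_X_le (R := ℂ)
        omega
    have e2 : ∀ x, x * (derivative p).eval x =
        ∑ n ∈ Finset.range N, (n * p.coeff n) * x ^ n := by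
      intro x
      have := eval_eq_sum_range' hdeg x
      rw [eval_mul, eval_X] at this
      rw [this]
      refine Finset.sum_congr rfl fun n _ => ?_
      cases n with
      | zero => simp
      | succ n =>
        rw [coeff_X_mul, coeff_derivative]
        push_cast
        ring
    calc _ = ∑ l, ∑ n ∈ Finset.range N, p.coeff n * ((a l + b l * n) * z l ^ n) := by
          refine Finset.sum_congr rfl fun l _ => ?_
          rw [e1, e2, Finset.mul_sum, Finset.mul_sum, ← Finset.sum_add_distrib]
          exact Finset.sum_congr rfl fun n _ => by ring
      _ = 0 := by
          rw [Finset.sum_comm]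
          refine Finset.sum_eq_zero fun n hn => ?_
          rw [← Finset.mul_sum, h n (Finset.mem_range.1 hn), mul_zero]
  -- `q l` vanishes to second order at all nodes except `z l`.
  let q : ι → ℂ[X] := fun l => ∏ j ∈ Finset.univ.erase l, (X - C (z j)) ^ 2
  have hq0 : ∀ l, (q l).eval (z l) ≠ 0 := by
    intro l
    simp only [q, eval_prod, eval_pow, eval_sub, eval_X, eval_C]
    refine Finset.prod_ne_zero_iff.2 fun j hj => pow_ne_zero _ (sub_ne_zero.2 fun e => ?_)
    exact (Finset.ne_of_mem_erase hj) (hz e).symm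
  have hqdeg : ∀ l, (q l).natDegree + 2 ≤ N := by
    intro l
    have : (q l).natDegree ≤ ∑ j ∈ Finset.univ.erase l, 2 := by
      refine (natDegree_prod_le _ _).trans (Finset.sum_le_sum fun j _ => ?_)
      rw [natDegree_pow, natDegree_X_sub_C]
    rw [Finset.sum_const, Finset.card_erase_of_mem (Finset.mem_univ l), Finset.card_univ,
      smul_eq_mul] at this
    have hpos : 0 < Fintype.card ι := Fintype.card_pos_iff.2 ⟨l⟩
    omega
  have hqj : ∀ l j, j ≠ l → ∀ r : ℂ[X], (r * q l).eval (z j) = 0 ∧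
      (derivative (r * q l)).eval (z j) = 0 := by
    intro l j hj r
    obtain ⟨w, hw⟩ : (X - C (z j)) ^ 2 ∣ q l :=
      Finset.dvd_prod_of_mem (fun j => (X - C (z j)) ^ 2)
        (Finset.mem_erase.2 ⟨hj, Finset.mem_univ j⟩)
    rw [hw]
    constructor <;> simp [derivative_mul, derivative_pow]
  have hb : ∀ l, b l = 0 := by
    intro l
    have hd : ((X - C (z l)) * q l).natDegree < N := by
      refine natDegree_mul_le.trans_lt ?_
      rw [natDegree_X_sub_C]
      have := hqdeg l
      omega
    have := hpoly _ hd
    rw [Finset.sum_eq_single l (fun j _ hj => by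
      rw [(hqj l j hj _).1, (hqj l j hj _).2]; simp) (by simp)] at this
    simpa [derivative_mul, hq0 l, hz0 l] using this
  have ha : ∀ l, a l = 0 := by
    intro l
    have hd : (1 * q l).natDegree < N := by
      rw [one_mul]
      have := hqdeg l
      omega
    have := hpoly _ hd
    rw [Finset.sum_eq_single l (fun j _ hj => by
      rw [(hqj l j hj _).1, (hqj l j hj _).2]; simp) (by simp)] at this
    simpa [hb l, hq0 l] using this
  exact ⟨funext ha, funext hb⟩

variable {L : ℕ} {τ : Fin L → ℝ} {β : Fin L → ℂ}

/-- The derivatives of the transfer function, sampled at the frequencies `n / N`, are linearly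
independent over the reals. -/
lemma eq_zero_of_sum_transferGrad_eq_zero (hβ : ∀ l, β l ≠ 0) {N : ℕ} (hN : 2 * L ≤ N)
    (hN0 : 0 < N) (hτ : ∀ k l, k ≠ l → ∀ m : ℤ, τ k - τ l ≠ m * N) {c : ParamIdx L → ℝ}
    (h : ∀ n < N, ∑ k, (c k : ℂ) * transferGrad τ β k ((n : ℕ) / N) = 0) : c = 0 := by
  have hNC : (N : ℂ) ≠ 0 := by exact_mod_cast hN0.ne'
  have hpi : (2 * Real.pi * Complex.I : ℂ) ≠ 0 := Complex.two_pi_I_ne_zero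
  set z : Fin L → ℂ := fun l => Complex.exp (-(2 * Real.pi * Complex.I * τ l / N)) with hz
  have hzinj : Function.Injective z := by
    intro k l hkl
    by_contra hne
    obtain ⟨m, hm⟩ := Complex.exp_eq_exp_iff_exists_int.1 hkl
    refine hτ k l hne (-m) ?_
    have : ((τ k : ℂ) - τ l) = -m * N := by
      field_simp at hm
      linear_combination -hm
    exact_mod_cast this
  have hpow : ∀ l (n : ℕ), Complex.exp (-(2 * Real.pi * Complex.I * ((n : ℝ) / N : ℝ) * τ l)) =
      z l ^ n := by
    intro l n
    rw [hz, ← Complex.exp_nat_mul]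
    congr 1
    push_cast
    ring
  obtain ⟨ha, hb⟩ := eq_zero_of_confluent_vandermonde (N := N) hzinj
    (fun l => Complex.exp_ne_zero _)
    (a := fun l => (c (Sum.inr (Sum.inl l)) : ℂ) + c (Sum.inr (Sum.inr l)) * Complex.I)
    (b := fun l => -(2 * Real.pi * Complex.I) * β l * c (Sum.inl l) / N) (by simpa using hN)
    (fun n hn => by
      rw [← h n hn]
      simp only [Fintype.sum_sum_type, transferGrad, Sum.elim_inl, Sum.elim_inr, hpow]
      rw [← Finset.sum_add_distrib, ← Finset.sum_add_distrib]
      refine Finset.sum_congr rfl fun l _ => ?_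
      push_cast
      field_simp
      ring)
  funext k
  rcases k with l | l | l
  · have := congrFun hb l
    simpa [hNC, hβ l, Real.pi_ne_zero] using this
  · simpa using congrArg Complex.re (congrFun ha l)
  · simpa using congrArg Complex.im (congrFun ha l)

lemma eventually_distinct_mod (hτ : Function.Injective τ) :
    ∀ᶠ N : ℕ in atTop, ∀ k l, k ≠ l → ∀ m : ℤ, τ k - τ l ≠ m * N := by
  simp only [eventually_all]
  intro k l hkl
  filter_upwards [eventually_gt_atTop ⌈|τ k - τ l|⌉₊] with N hN m hm
  have h1 : |τ k - τ l| < N := Nat.lt_of_ceil_lt hN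
  have hm0 : m ≠ 0 := by
    rintro rfl
    exact hkl (hτ (sub_eq_zero.1 (by simpa using hm)))
  have h2 : (1 : ℝ) ≤ |(m : ℝ)| := by exact_mod_cast Int.one_le_abs hm0
  rw [hm, abs_mul, Nat.abs_cast] at h1
  nlinarith [Nat.cast_nonneg (α := ℝ) N]

end Independence

/-! ### Gram matrices and their large-`N` limit -/

section Gram

open Matrix

variable {L : ℕ} {τ : Fin L → ℝ} {β : Fin L → ℂ}

lemma isUnit_of_quadratic_form {ι : Type*} [Fintype ι] [DecidableEq ι] {A : Matrix ι ι ℝ}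
    (h : ∀ c, c ⬝ᵥ A *ᵥ c = 0 → c = 0) : IsUnit A := by
  rw [← mulVec_injective_iff_isUnit]
  intro x y hxy
  refine sub_eq_zero.1 (h _ ?_)
  have : A *ᵥ (x - y) = 0 := by rw [mulVec_sub]; exact sub_eq_zero.2 hxy
  rw [this, dotProduct_zero]

/-- The quadratic form of the weights is a squared modulus; its sum or integral over `x` is
therefore a positive semidefinite form. -/
lemma sum_fimWeight (c : ParamIdx L → ℝ) (x : ℝ) :
    ∑ k, ∑ l, c k * (fimWeight τ β k l x * c l) = ‖∑ k, (c k : ℂ) * transferGrad τ β k x‖ ^ 2 := by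
  set w := ∑ k, (c k : ℂ) * transferGrad τ β k x with hw
  have h : ‖w‖ ^ 2 = (star w * w).re := by
    rw [← Complex.normSq_eq_norm_sq, Complex.normSq_apply]; simp
  rw [h, hw, star_sum, Finset.sum_mul_sum, Complex.re_sum]
  refine Finset.sum_congr rfl fun k _ => ?_
  rw [Complex.re_sum]
  refine Finset.sum_congr rfl fun l _ => ?_
  have : star ((c k : ℂ) * transferGrad τ β k x) * (c l * transferGrad τ β l x) =
      ((c k * c l : ℝ) : ℂ) * (star (transferGrad τ β k x) * transferGrad τ β l x) := by
    rw [star_mul']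
    simp only [RCLike.star_def, Complex.conj_ofReal]
    push_cast
    ring
  rw [this, Complex.re_ofReal_mul, fimWeight]
  ring

/-- The real Gram matrix of the derivatives of the transfer function at the frequencies `n / N`,
which is not divided by `N`. -/
def sampledGram (N : ℕ) (τ : Fin L → ℝ) (β : Fin L → ℂ) : Matrix (ParamIdx L) (ParamIdx L) ℝ :=
  of fun k l => ∑ n : Fin N, fimWeight τ β k l ((n : ℕ) / N)

/-- The real Gram matrix of the derivatives of the transfer function in `L²([0, 1])`. -/
def limitGram (τ : Fin L → ℝ) (β : Fin L → ℂ) : Matrix (ParamIdx L) (ParamIdx L) ℝ :=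
  of fun k l => ∫ x in (0 : ℝ)..1, fimWeight τ β k l x

lemma continuous_transferGrad (k : ParamIdx L) : Continuous (transferGrad τ β k) := by
  rcases k with l | l | l <;> unfold transferGrad <;> simp only [Sum.elim_inl, Sum.elim_inr] <;>
    fun_prop

lemma continuous_fimWeight (k l : ParamIdx L) : Continuous (fimWeight τ β k l) :=
  Complex.continuous_re.comp
    ((continuous_star.comp (continuous_transferGrad k)).mul (continuous_transferGrad l))

lemma isUnit_sampledGram (hβ : ∀ l, β l ≠ 0) {N : ℕ} (hN : 2 * L ≤ N)
    (hN0 : 0 < N) (hτ : ∀ k l, k ≠ l → ∀ m : ℤ, τ k - τ l ≠ m * N) :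
    IsUnit (sampledGram N τ β) := by
  refine isUnit_of_quadratic_form fun c hc => ?_
  refine eq_zero_of_sum_transferGrad_eq_zero hβ hN hN0 hτ ?_
  have e : c ⬝ᵥ sampledGram N τ β *ᵥ c =
      ∑ n : Fin N, ‖∑ k, (c k : ℂ) * transferGrad τ β k ((n : ℕ) / N)‖ ^ 2 := by
    simp only [← sum_fimWeight, dotProduct, mulVec, sampledGram, of_apply, Finset.mul_sum,
      Finset.sum_mul]
    rw [Finset.sum_comm_cycle, Finset.sum_comm_cycle]
  rw [e, Finset.sum_eq_zero_iff_of_nonneg fun n _ => by positivity] at hc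
  intro n hn
  simpa using hc ⟨n, hn⟩ (Finset.mem_univ _)

/-- The derivatives of the transfer function are linearly independent on `[0, 1]`, since they
already are on the grid of the frequencies `n / N` for a large `N`. -/
lemma isUnit_limitGram (hβ : ∀ l, β l ≠ 0) (hτ : Function.Injective τ) :
    IsUnit (limitGram τ β) := by
  refine isUnit_of_quadratic_form fun c hc => ?_
  have hcont : Continuous fun x => ‖∑ k, (c k : ℂ) * transferGrad τ β k x‖ ^ 2 :=
    (continuous_finsetSum _ fun k _ =>
      continuous_const.mul (continuous_transferGrad k)).norm.pow 2
  have hc' : ∀ k l, Continuous fun x => c k * (fimWeight τ β k l x * c l) := fun k l =>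
    continuous_const.mul ((continuous_fimWeight k l).mul continuous_const)
  have e : c ⬝ᵥ limitGram τ β *ᵥ c =
      ∫ x in (0 : ℝ)..1, ‖∑ k, (c k : ℂ) * transferGrad τ β k x‖ ^ 2 := by
    simp only [← sum_fimWeight]
    rw [intervalIntegral.integral_finsetSum fun k _ =>
      (continuous_finsetSum _ fun l _ => hc' k l).intervalIntegrable 0 1]
    simp only [dotProduct, mulVec, limitGram, of_apply, Finset.mul_sum]
    refine Finset.sum_congr rfl fun k _ => ?_
    rw [intervalIntegral.integral_finsetSum fun l _ => (hc' k l).intervalIntegrable 0 1]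
    simp only [intervalIntegral.integral_const_mul, intervalIntegral.integral_mul_const]
  have hzero : ∀ x ∈ Set.Icc (0 : ℝ) 1, ∑ k, (c k : ℂ) * transferGrad τ β k x = 0 := by
    by_contra! hx
    obtain ⟨x, hx, hne⟩ := hx
    have := intervalIntegral.integral_pos zero_lt_one hcont.continuousOn
      (fun x _ => by positivity) ⟨x, hx, by positivity⟩
    rw [← e, hc] at this
    exact this.false
  obtain ⟨N, hmod, hN⟩ :=
    ((eventually_distinct_mod hτ).and (eventually_ge_atTop (2 * L + 1))).exists
  refine eq_zero_of_sum_transferGrad_eq_zero hβ (by omega) (by omega) hmod fun n hn => ?_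
  refine hzero _ ⟨by positivity, ?_⟩
  exact div_le_one_of_le₀ (by exact_mod_cast hn.le) (by positivity)

/-- Convergence of the left Riemann sums of a continuous function on `[0, 1]`. -/
lemma tendsto_riemann_sum {f : ℝ → ℝ} (hf : Continuous f) :
    Tendsto (fun N : ℕ => (N : ℝ)⁻¹ * ∑ n : Fin N, f ((n : ℕ) / N)) atTop
      (nhds (∫ x in (0 : ℝ)..1, f x)) := by
  rw [Metric.tendsto_atTop]
  intro ε hε
  obtain ⟨δ, hδ, hu⟩ := Metric.uniformContinuousOn_iff.1
    (isCompact_Icc.uniformContinuousOn_of_continuous (hf.continuousOn (s := Set.Icc 0 1)))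
    (ε / 2) (by positivity)
  refine ⟨⌈δ⁻¹⌉₊ + 1, fun N hN => ?_⟩
  have hNδ : δ⁻¹ < N := Nat.lt_of_ceil_lt hN
  have hN0 : (0 : ℝ) < N := (inv_pos.2 hδ).trans hNδ
  have hNinv : (N : ℝ)⁻¹ < δ := inv_lt_of_inv_lt₀ hδ hNδ
  have hsum : ∫ x in (0 : ℝ)..1, f x =
      ∑ n ∈ Finset.range N, ∫ x in ((n : ℕ) / N : ℝ)..((n + 1 : ℕ) / N : ℝ), f x := by
    rw [intervalIntegral.sum_integral_adjacent_intervals (a := fun n : ℕ => (n / N : ℝ))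
      fun n _ => hf.intervalIntegrable _ _]
    simp [hN0.ne']
  have hstep : ∀ n ∈ Finset.range N, |(N : ℝ)⁻¹ * f ((n : ℕ) / N) -
      ∫ x in ((n : ℕ) / N : ℝ)..((n + 1 : ℕ) / N : ℝ), f x| ≤ ε / 2 * (N : ℝ)⁻¹ := by
    intro n hn
    have hlen : ((n + 1 : ℕ) / N : ℝ) - (n : ℕ) / N = (N : ℝ)⁻¹ := by
      push_cast
      field_simp
      ring
    have hn1 : ((n + 1 : ℕ) : ℝ) / N ≤ 1 :=
      div_le_one_of_le₀ (by exact_mod_cast Finset.mem_range.1 hn) hN0.le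
    have hn0 : (0 : ℝ) ≤ (n : ℕ) / N := by positivity
    have e : (N : ℝ)⁻¹ * f ((n : ℕ) / N) - ∫ x in ((n : ℕ) / N : ℝ)..((n + 1 : ℕ) / N : ℝ), f x =
        ∫ x in ((n : ℕ) / N : ℝ)..((n + 1 : ℕ) / N : ℝ), (f ((n : ℕ) / N) - f x) := by
      rw [intervalIntegral.integral_sub intervalIntegrable_const (hf.intervalIntegrable _ _),
        intervalIntegral.integral_const, hlen, smul_eq_mul]
    have hle : ((n : ℕ) / N : ℝ) ≤ ((n + 1 : ℕ) / N : ℝ) := by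
      rw [← sub_nonneg, hlen]; positivity
    rw [e, ← Real.norm_eq_abs]
    refine (intervalIntegral.norm_integral_le_of_norm_le_const (C := ε / 2)
      fun x hx => ?_).trans (le_of_eq ?_)
    · rw [Set.uIoc_of_le hle] at hx
      have hd : dist ((n : ℕ) / N : ℝ) x < δ := by
        rw [dist_comm, Real.dist_eq, abs_of_pos (sub_pos.2 hx.1)]
        linarith [hx.2]
      have := hu ((n : ℕ) / N) ⟨hn0, hle.trans hn1⟩ x ⟨hn0.trans hx.1.le, hx.2.trans hn1⟩ hd
      rw [Real.dist_eq] at this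
      exact this.le
    · rw [hlen, abs_of_pos (inv_pos.2 hN0)]
  rw [Real.dist_eq, hsum, Fin.sum_univ_eq_sum_range (fun n => f ((n : ℕ) / N)) N,
    Finset.mul_sum, ← Finset.sum_sub_distrib]
  calc _ ≤ ∑ n ∈ Finset.range N, ε / 2 * (N : ℝ)⁻¹ :=
        (Finset.abs_sum_le_sum_abs _ _).trans (Finset.sum_le_sum hstep)
    _ = ε / 2 := by
        rw [Finset.sum_const, Finset.card_range, nsmul_eq_mul]
        field_simp
    _ < ε := by linarith

lemma tendsto_sampledGram (τ : Fin L → ℝ) (β : Fin L → ℂ) :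
    Tendsto (fun N : ℕ => (N : ℝ)⁻¹ • sampledGram N τ β) atTop (nhds (limitGram τ β)) := by
  refine tendsto_pi_nhds.2 fun k => tendsto_pi_nhds.2 fun l => ?_
  exact tendsto_riemann_sum (continuous_fimWeight k l)

end Gram

/-! ### Almost sure convergence and inversion -/

section Limit

open Matrix Topology

variable {Ω : Type*} [MeasurableSpace Ω] {P : Measure Ω}

/-- Almost sure convergence from summable fourth moments; no assumption is made on the joint
distribution of the sequence. -/
lemma ae_tendsto_zero_of_integral_pow_four_le [IsFiniteMeasure P] {X : ℕ → Ω → ℝ}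
    (hX : ∀ N, MemLp (X N) ⊤ P) {b : ℕ → ℝ} (hb : Summable b)
    (h : ∀ N, ∫ ω, X N ω ^ 4 ∂P ≤ b N) : ∀ᵐ ω ∂P, Tendsto (fun N => X N ω) atTop (𝓝 0) := by
  have hint : ∀ N, Integrable (fun ω => X N ω ^ 4) P := fun N =>
    (memLp_top_pow (hX N) 4).integrable le_top
  have hm : ∀ N, AEMeasurable (fun ω => ENNReal.ofReal (X N ω ^ 4)) P := fun N =>
    (hint N).aestronglyMeasurable.aemeasurable.ennreal_ofReal
  have hfin : ∫⁻ ω, ∑' N, ENNReal.ofReal (X N ω ^ 4) ∂P ≠ ⊤ := by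
    rw [lintegral_tsum hm]
    refine ne_top_of_le_ne_top hb.tsum_ofReal_ne_top (ENNReal.tsum_le_tsum fun N => ?_)
    rw [← ofReal_integral_eq_lintegral_ofReal (hint N)
      (Eventually.of_forall fun ω => by positivity)]
    exact ENNReal.ofReal_le_ofReal (h N)
  filter_upwards [ae_lt_top' (AEMeasurable.tsum hm) hfin] with ω hω
  have h1 := ENNReal.tendsto_atTop_zero_of_tsum_ne_top hω.ne
  have h2 : Tendsto (fun N => X N ω ^ 4) atTop (𝓝 0) := by
    have := (ENNReal.tendsto_toReal ENNReal.zero_ne_top).comp h1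
    refine this.congr fun N => ?_
    exact ENNReal.toReal_ofReal (by positivity)
  have h3 := h2.sqrt.sqrt
  simp only [Real.sqrt_zero] at h3
  rw [tendsto_zero_iff_abs_tendsto_zero]
  refine h3.congr fun N => ?_
  rw [show X N ω ^ 4 = (X N ω ^ 2) ^ 2 by ring, Real.sqrt_sq (sq_nonneg _), Real.sqrt_sq_eq_abs]
  rfl

variable {ι : Type*} [Fintype ι] [DecidableEq ι]

/-- `J = J̄ (1 + Z)`, and `1 + Z` is invertible by the Neumann series when `‖Z‖ < 1`. -/
lemma isUnit_of_mem_neumannEvent {J : Ω → Matrix ι ι ℝ} {ρ : ℝ} (hρ : ρ ≤ 1)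
    (hJ : IsUnit (expectedMatrix P J)) {ω : Ω} (hω : ω ∈ neumannEvent P J ρ) : IsUnit (J ω) := by
  set E := toEuclideanCLM (n := ι) (𝕜 := ℝ)
  have hnorm : ‖-E (perturbation P J ω)‖ < 1 := by
    rw [norm_neg]
    exact lt_of_lt_of_le hω hρ
  have h1 : IsUnit (1 + perturbation P J ω) := by
    rw [← MulEquiv.isUnit_map E]
    have := isUnit_one_sub_of_norm_lt_one hnorm
    rwa [sub_neg_eq_add, ← map_one E, ← map_add] at this
  have h2 : J ω = expectedMatrix P J * (1 + perturbation P J ω) := by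
    rw [mul_add, mul_one, perturbation,
      mul_nonsing_inv_cancel_left _ _ ((isUnit_iff_isUnit_det _).1 hJ), add_sub_cancel]
  rw [h2]
  exact hJ.mul h1

/-- The normalized perturbation does not change when `J` is scaled, so both `J̄` and `J - J̄` may be
divided by `N`: if `J̄ N / N` has an invertible limit and `(J N - J̄ N) / N` tends to
zero, then the perturbations tend to zero. -/
lemma eventually_mem_neumannEvent {J : ℕ → Ω → Matrix ι ι ℝ} {K : Matrix ι ι ℝ} (hK : IsUnit K)
    (hmean : Tendsto (fun N : ℕ => (N : ℝ)⁻¹ • expectedMatrix P (J N)) atTop (𝓝 K)) {ω : Ω}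
    (hdev : Tendsto (fun N : ℕ => (N : ℝ)⁻¹ • (J N ω - expectedMatrix P (J N))) atTop (𝓝 0))
    {ρ : ℝ} (hρ : 0 < ρ) : ∀ᶠ N in atTop, ω ∈ neumannEvent P (J N) ρ := by
  have hdet : K.det ≠ 0 := ((isUnit_iff_isUnit_det _).1 hK).ne_zero
  have hinv : Tendsto (fun N : ℕ => ((N : ℝ)⁻¹ • expectedMatrix P (J N))⁻¹) atTop (𝓝 K⁻¹) := by
    refine Tendsto.comp (continuousAt_matrix_inv K ?_) hmean
    rw [Ring.inverse_eq_inv']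
    exact continuousAt_inv₀ hdet
  have hZ : Tendsto (fun N => perturbation P (J N) ω) atTop (𝓝 0) := by
    have h := hinv.mul hdev
    rw [mul_zero] at h
    refine h.congr' ?_
    have hd : ∀ᶠ N : ℕ in atTop, ((N : ℝ)⁻¹ • expectedMatrix P (J N)).det ≠ 0 :=
      ((continuous_id.matrix_det.tendsto K).comp hmean).eventually_ne hdet
    filter_upwards [eventually_gt_atTop 0, hd] with N hN hdN
    have hN' : (N : ℝ)⁻¹ ≠ 0 := by positivity
    have hu : IsUnit (expectedMatrix P (J N)).det := by
      rw [det_smul] at hdN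
      exact (right_ne_zero_of_mul hdN).isUnit
    let _ := invertibleOfNonzero hN'
    rw [Matrix.inv_smul _ _ hu, perturbation, smul_mul_smul_comm, invOf_mul_self, one_smul]
  have hcont : Continuous fun A : Matrix ι ι ℝ => specNorm A :=
    (LinearMap.continuous_of_finiteDimensional
      (toEuclideanCLM (n := ι) (𝕜 := ℝ)).toAlgEquiv.toLinearMap).norm
  have := (hcont.tendsto 0).comp hZ
  rw [show specNorm (0 : Matrix ι ι ℝ) = 0 by simp [specNorm]] at this
  exact this.eventually_lt_const hρ

end Limit

section Ranging

open Matrix Topology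

variable {Ω : Type*} [MeasurableSpace Ω] {P : Measure Ω}

lemma isSymbolVector_of_hasLaw {ι : Type*} {S : Finset ℂ} {ν : Measure ℂ}
    (hS : ∀ᵐ z ∂ν, z ∈ S) (hmean : ∫ z, z ∂ν = 0) (hpower : ∫ z, ‖z‖ ^ 2 ∂ν = 1)
    {s : ι → Ω → ℂ} (hlaw : ∀ n, HasLaw (s n) ν P) (hindep : iIndepFun s P) :
    IsSymbolVector P (1 + ∑ z ∈ S, ‖z‖) s where
  aemeasurable i := (hlaw i).aemeasurable
  indep := hindep
  integral_eq_zero i := by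
    rw [← hmean, ← (hlaw i).map_eq, integral_map (hlaw i).aemeasurable (by fun_prop)]
  integral_norm_sq i := by
    rw [← hpower, ← (hlaw i).map_eq, integral_map (hlaw i).aemeasurable (by fun_prop)]
  norm_le i := by
    rw [← (hlaw i).map_eq] at hS
    filter_upwards [ae_of_ae_map (hlaw i).aemeasurable hS] with ω hω
    have := Finset.single_le_sum (f := fun z : ℂ => ‖z‖) (fun z _ => norm_nonneg z) hω
    linarith

variable [IsProbabilityMeasure P] {L N : ℕ} {M : ℝ}

lemma dft_mul_mem_unitaryGroup {U : Matrix (Fin N) (Fin N) ℂ}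
    (hU : U ∈ unitaryGroup (Fin N) ℂ) : dft N * U ∈ unitaryGroup (Fin N) ℂ :=
  mul_mem (dft_mem_unitaryGroup N) hU

/-- The expected Fisher information matrix is a multiple of the sampled Gram matrix, whatever the
unitary waveform. -/
lemma expectedMatrix_randomFIM (σ : ℝ) (τ : Fin L → ℝ) (β : Fin L → ℂ)
    {U : Matrix (Fin N) (Fin N) ℂ} (hU : U ∈ unitaryGroup (Fin N) ℂ) {s : Fin N → Ω → ℂ}
    (hs : IsSymbolVector P M s) :
    expectedMatrix P (randomFIM σ τ β U s) = (2 / σ ^ 2) • sampledGram N τ β := by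
  ext k l
  simp only [expectedMatrix, randomFIM, fim_apply, of_apply, Matrix.smul_apply, smul_eq_mul,
    sampledGram]
  rw [integral_const_mul, hs.integral_quadForm_unitary (dft_mul_mem_unitaryGroup hU)]

lemma randomFIM_sub_expectedMatrix (σ : ℝ) (τ : Fin L → ℝ) (β : Fin L → ℂ)
    {U : Matrix (Fin N) (Fin N) ℂ} (hU : U ∈ unitaryGroup (Fin N) ℂ) {s : Fin N → Ω → ℂ}
    (hs : IsSymbolVector P M s) (ω : Ω) (k l : ParamIdx L) :
    (randomFIM σ τ β U s ω - expectedMatrix P (randomFIM σ τ β U s)) k l =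
      2 / σ ^ 2 * quadDev (fun n : Fin N => fimWeight τ β k l ((n : ℕ) / N)) (dft N * U)
        Finset.univ (fun n => s n ω) := by
  rw [expectedMatrix_randomFIM σ τ β hU hs, quadDev_unitary (dft_mul_mem_unitaryGroup hU)]
  simp only [Matrix.sub_apply, randomFIM, fim_apply, Matrix.smul_apply, smul_eq_mul,
    sampledGram, of_apply]
  ring

lemma exists_abs_fimWeight_le (τ : Fin L → ℝ) (β : Fin L → ℂ) (k l : ParamIdx L) :
    ∃ H, 0 ≤ H ∧ ∀ N, ∀ n : Fin N, |fimWeight τ β k l ((n : ℕ) / N)| ≤ H := by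
  obtain ⟨H, hH⟩ := (isCompact_Icc (a := (0 : ℝ)) (b := 1)).exists_bound_of_continuousOn
    (continuous_fimWeight (τ := τ) (β := β) k l).continuousOn
  refine ⟨H, (norm_nonneg _).trans (hH 0 (by simp)), fun N n => hH _ ⟨by positivity, ?_⟩⟩
  exact div_le_one_of_le₀ (by exact_mod_cast n.isLt.le) (by positivity)

/-- Almost surely, the Fisher information matrix per symbol approaches its mean. -/
lemma ae_tendsto_randomFIM_sub (σ : ℝ) (τ : Fin L → ℝ) (β : Fin L → ℂ)
    {U : ∀ N : ℕ, Matrix (Fin N) (Fin N) ℂ} (hU : ∀ N, U N ∈ unitaryGroup (Fin N) ℂ)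
    {s : ∀ N : ℕ, Fin N → Ω → ℂ} (hM : 1 ≤ M) (hs : ∀ N, IsSymbolVector P M (s N)) :
    ∀ᵐ ω ∂P, Tendsto (fun N : ℕ => (N : ℝ)⁻¹ • (randomFIM σ τ β (U N) (s N) ω -
      expectedMatrix P (randomFIM σ τ β (U N) (s N)))) atTop (𝓝 0) := by
  have hkl : ∀ k l, ∀ᵐ ω ∂P, Tendsto (fun N : ℕ => (N : ℝ)⁻¹ *
      quadDev (fun n : Fin N => fimWeight τ β k l ((n : ℕ) / N)) (dft N * U N)
        Finset.univ (fun n => s N n ω)) atTop (𝓝 0) := by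
    intro k l
    obtain ⟨H, hH0, hH⟩ := exists_abs_fimWeight_le τ β k l
    refine ae_tendsto_zero_of_integral_pow_four_le (fun N =>
      ((hs N).memLp_quadDev _ (dft N * U N) Finset.univ).const_mul _)
      (b := fun N : ℕ => (368 * H ^ 2 * M ^ 4) ^ 2 * (1 / (N : ℝ) ^ 2))
      ((Real.summable_one_div_nat_pow.2 one_lt_two).mul_left _) fun N => ?_
    have h4 := (hs N).integral_quadDev_unitary_pow_four_le hM (dft_mul_mem_unitaryGroup (hU N))
      hH0 (hH N)
    simp only [mul_pow _ _ 4]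
    rw [integral_const_mul]
    rcases Nat.eq_zero_or_pos N with rfl | hN
    · simp
    calc _ ≤ (N : ℝ)⁻¹ ^ 4 * (368 * H ^ 2 * M ^ 4 * Fintype.card (Fin N)) ^ 2 := by gcongr
      _ = _ := by
        rw [Fintype.card_fin]
        field_simp
  have hall := ae_all_iff.2 fun k => ae_all_iff.2 (hkl k)
  filter_upwards [hall] with ω hω
  refine tendsto_pi_nhds.2 fun k => tendsto_pi_nhds.2 fun l => ?_
  have := (hω k l).const_mul (2 / σ ^ 2)
  rw [mul_zero] at this
  refine this.congr fun N => ?_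
  rw [Matrix.smul_apply, randomFIM_sub_expectedMatrix σ τ β (hU N) (hs N), smul_eq_mul]
  ring

end Ranging

end RangingCRB

end

theorem proposition2 {Ω : Type*} [MeasurableSpace Ω] (P : Measure Ω) [IsProbabilityMeasure P]
    -- the targets and the noise level, all fixed as the block length `N` grows
    (L : ℕ) (τ : Fin L → ℝ) (hτ : Function.Injective τ)
    (β : Fin L → ℂ) (hβ : ∀ l, β l ≠ 0)
    (σ : ℝ) (hσ : 0 < σ)
    -- the constellation `S` and the distribution `ν` of a symbol: zero mean and unit power
    (S : Finset ℂ) (ν : Measure ℂ) [IsProbabilityMeasure ν] (hS : ∀ᵐ z ∂ν, z ∈ S)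
    (hmean : ∫ z, z ∂ν = 0) (hpower : ∫ z, ‖z‖ ^ 2 ∂ν = 1)
    -- the waveforms, and for every `N` a vector of `N` independent symbols; nothing is assumed
    -- about the joint distribution of the vectors for different `N`
    (U : ∀ N : ℕ, Matrix (Fin N) (Fin N) ℂ) (hU : ∀ N, U N ∈ Matrix.unitaryGroup (Fin N) ℂ)
    (s : ∀ N : ℕ, Fin N → Ω → ℂ)
    (hlaw : ∀ N n, HasLaw (s N n) ν P) (hindep : ∀ N, iIndepFun (s N) P)
    (ρ : ℝ) (hρ0 : 0 < ρ) (hρ1 : ρ < 1) :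
    -- almost surely, the event occurs for all sufficiently large `N`
    (∀ᵐ ω ∂P, ∀ᶠ N in atTop,
      ω ∈ RangingCRB.neumannEvent P (RangingCRB.randomFIM σ τ β (U N) (s N)) ρ) ∧
    -- for `N > 3L` and delays that are distinct modulo `N`, the expected FIM is invertible, and
    -- the FIM is invertible on the event
    (∀ N : ℕ, 3 * L < N → (∀ k l, k ≠ l → ∀ m : ℤ, τ k - τ l ≠ m * N) →
      IsUnit (RangingCRB.expectedMatrix P (RangingCRB.randomFIM σ τ β (U N) (s N))) ∧
      ∀ ω ∈ RangingCRB.neumannEvent P (RangingCRB.randomFIM σ τ β (U N) (s N)) ρ,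
        IsUnit (RangingCRB.randomFIM σ τ β (U N) (s N) ω)) ∧
    -- hence, almost surely, the FIM is invertible for all sufficiently large `N`
    (∀ᵐ ω ∂P, ∀ᶠ N in atTop, IsUnit (RangingCRB.randomFIM σ τ β (U N) (s N) ω)) := by
  have hs : ∀ N, RangingCRB.IsSymbolVector P (1 + ∑ z ∈ S, ‖z‖) (s N) := fun N =>
    RangingCRB.isSymbolVector_of_hasLaw hS hmean hpower (hlaw N) (hindep N)
  have hM : 1 ≤ 1 + ∑ z ∈ S, ‖z‖ :=
    le_add_of_nonneg_right (Finset.sum_nonneg fun z _ => norm_nonneg z)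
  have hc : 2 / σ ^ 2 ≠ 0 := by positivity
  have hunit : ∀ A : Matrix (RangingCRB.ParamIdx L) (RangingCRB.ParamIdx L) ℝ, IsUnit A →
      IsUnit ((2 / σ ^ 2) • A) := fun A hA => hA.smul (Units.mk0 _ hc)
  have hevent : ∀ᵐ ω ∂P, ∀ᶠ N in atTop,
      ω ∈ RangingCRB.neumannEvent P (RangingCRB.randomFIM σ τ β (U N) (s N)) ρ := by
    filter_upwards [RangingCRB.ae_tendsto_randomFIM_sub σ τ β hU hM hs] with ω hω
    refine RangingCRB.eventually_mem_neumannEvent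
      (hunit _ (RangingCRB.isUnit_limitGram hβ hτ)) ?_ hω hρ0
    refine ((RangingCRB.tendsto_sampledGram τ β).const_smul (2 / σ ^ 2)).congr fun N => ?_
    rw [RangingCRB.expectedMatrix_randomFIM σ τ β (hU N) (hs N), smul_comm]
  have hinv : ∀ N : ℕ, 3 * L < N → (∀ k l, k ≠ l → ∀ m : ℤ, τ k - τ l ≠ m * N) →
      IsUnit (RangingCRB.expectedMatrix P (RangingCRB.randomFIM σ τ β (U N) (s N))) ∧
      ∀ ω ∈ RangingCRB.neumannEvent P (RangingCRB.randomFIM σ τ β (U N) (s N)) ρ,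
        IsUnit (RangingCRB.randomFIM σ τ β (U N) (s N) ω) := by
    intro N hN hmod
    have hJ : IsUnit (RangingCRB.expectedMatrix P (RangingCRB.randomFIM σ τ β (U N) (s N))) := by
      rw [RangingCRB.expectedMatrix_randomFIM σ τ β (hU N) (hs N)]
      exact hunit _ (RangingCRB.isUnit_sampledGram hβ (by omega) (by omega) hmod)
    exact ⟨hJ, fun ω hω => RangingCRB.isUnit_of_mem_neumannEvent hρ1.le hJ hω⟩
  refine ⟨hevent, hinv, ?_⟩
  filter_upwards [hevent] with ω hω
  filter_upwards [hω, eventually_gt_atTop (3 * L), RangingCRB.eventually_distinct_mod hτ]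
    with N h1 h2 h3
  exact (hinv N h2 h3).2 ω h1
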